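/- For a finite simple graph $G$ and a set $S$ of vertices let $B(S)$ be the set of vertices outside $S$ that have a neighbour in $S$, let $B_{i,j}(G)$ be the number of sets $S\subseteq V(G)$ with $|B(S)|=i$ and $|S|=j$, and let $B(G;x,y)=\sum_{S\subseteq V(G)}x^{|B(S)|}y^{|S|}$ be the boundary polynomial of $G$. Let $G_1,G_2$ be finite simple graphs of orders $n_1,n_2\ge 2$ without isolated vertices, and let $\alpha_1,\alpha_2,\alpha_3,\alpha_4\in\mathbb R$ satisfy $\alpha_1+\alpha_4=0$ and $\sigma:=\alpha_1\alpha_4-\alpha_2\alpha_3>0$ (so $\alpha_2\neq0$). Consider the planar analytic system $$\frac{dx}{dt}=\alpha_1x+\alpha_2y+B(G_1;x,y)-1,\qquad \frac{dy}{dt}=\alpha_3x+\alpha_4y+B(G_2;x,y)-1 .$$ Put $$\begin{aligned}\widetilde\sigma_B=-\frac{3\pi}{2\alpha_2\sigma^{3/2}}\Big[&\alpha_1\alpha_3\big(B_{1,1}(G_1)^2+B_{1,1}(G_1)B_{0,2}(G_2)+B_{0,2}(G_1)B_{1,1}(G_2)\big)+\alpha_1\alpha_2B_{1,1}(G_2)^2\\&+\alpha_3^2\big(B_{1,1}(G_1)B_{0,2}(G_1)+2B_{0,2}(G_1)B_{0,2}(G_2)\big)-2\alpha_1\alpha_3B_{0,2}(G_2)^2+(\alpha_2\alpha_3-2\alpha_1^2)B_{1,1}(G_2)B_{0,2}(G_2)\\&-(\alpha_1^2+\alpha_2\alpha_3)\big(3\alpha_3B_{0,3}(G_2)+2\alpha_1(B_{2,1}(G_1)+B_{1,2}(G_2))+\alpha_3B_{1,2}(G_1)-\alpha_2B_{2,1}(G_2)\big)\Big].\end{aligned}$$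 Then the Jacobian matrix of the system at the origin has the pair of purely imaginary eigenvalues $\pm i\sqrt\sigma$; the origin is a center or a focus, and it is a focus if $\widetilde\sigma_B\ne0$; and $\widetilde\sigma_B$ is the generalized Liapunov number of the origin. The latter means the following. Let $P$ be the Poincaré (first return) map at the origin on the line $\alpha_1x+\alpha_2y=0$, parametrized by the abscissa $s=x$: for small $s\neq0$ the orbit through the point of the line with abscissa $s$ returns for the first time to the same open half-line at the point with abscissa $P(s)$, and $P(0)=0$. (This line is the $\xi$-axis in the coordinates $\xi=x$, $\eta=-(\alpha_1x+\alpha_2y)/\sqrt\sigma$, in which the linear part is $(\xi,\eta)\mapsto(-\sqrt\sigma\,\eta,\sqrt\sigma\,\xi)$.) Then $P$ is analytic at $0$, $P'(0)=1$, and the displacement function $d(s)=P(s)-s$ satisfies $d'''(0)=\widetilde\sigma_B$. -/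

import Mathlib

/-! ### Boundary polynomials of finite graphs -/

/-- The (outer vertex) boundary of a set `S` of vertices: the vertices outside `S` that have a
neighbour in `S`. -/
def SimpleGraph.vertexBoundary {V : Type*} [Fintype V] [DecidableEq V] (G : SimpleGraph V)
    [DecidableRel G.Adj] (S : Finset V) : Finset V :=
  Finset.univ.filter fun v => v ∉ S ∧ ∃ u ∈ S, G.Adj u v

/-- The boundary polynomial `B(G; x, y) = ∑_{S ⊆ V(G)} x ^ |B(S)| * y ^ |S|`, as a function of the
real variables `x` and `y`. -/
def SimpleGraph.boundaryPolynomial {V : Type*} [Fintype V] [DecidableEq V] (G : SimpleGraph V)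
    [DecidableRel G.Adj] (x y : ℝ) : ℝ :=
  ∑ S : Finset V, x ^ (G.vertexBoundary S).card * y ^ S.card

/-- The coefficient `B_{i,j}(G)`: the number of vertex sets `S` with `|B(S)| = i` and `|S| = j`. -/
def SimpleGraph.boundaryCoeff {V : Type*} [Fintype V] [DecidableEq V] (G : SimpleGraph V)
    [DecidableRel G.Adj] (i j : ℕ) : ℕ :=
  (Finset.univ.filter fun S : Finset V => (G.vertexBoundary S).card = i ∧ S.card = j).card

/-- The planar vector field with linear part `!![a₁, a₂; a₃, a₄]` and nonlinear part
`(B(G₁; x, y) - 1, B(G₂; x, y) - 1)`. -/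
def boundaryField {V₁ V₂ : Type*} [Fintype V₁] [DecidableEq V₁] [Fintype V₂] [DecidableEq V₂]
    (G₁ : SimpleGraph V₁) [DecidableRel G₁.Adj] (G₂ : SimpleGraph V₂) [DecidableRel G₂.Adj]
    (a₁ a₂ a₃ a₄ : ℝ) (p : ℝ × ℝ) : ℝ × ℝ :=
  (a₁ * p.1 + a₂ * p.2 + G₁.boundaryPolynomial p.1 p.2 - 1,
   a₃ * p.1 + a₄ * p.2 + G₂.boundaryPolynomial p.1 p.2 - 1)

/-! ### Planar vector fields near an equilibrium at the origin -/

/-- The Jacobian matrix of a planar vector field at a point. -/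
noncomputable def jacobianMatrix (F : ℝ × ℝ → ℝ × ℝ) (p : ℝ × ℝ) : Matrix (Fin 2) (Fin 2) ℝ :=
  LinearMap.toMatrix (Module.Basis.finTwoProd ℝ) (Module.Basis.finTwoProd ℝ)
    (fderiv ℝ F p : ℝ × ℝ →ₗ[ℝ] ℝ × ℝ)

/-- `γ` avoids the origin on `I` and `(r, θ)` are continuous polar coordinates along it. -/
def IsPolarOn (γ : ℝ → ℝ × ℝ) (r θ : ℝ → ℝ) (I : Set ℝ) : Prop :=
  ContinuousOn r I ∧ ContinuousOn θ I ∧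
    ∀ t ∈ I, 0 < r t ∧ γ t = (r t * Real.cos (θ t), r t * Real.sin (θ t))

/-- The origin is a center: every orbit through a point close to, and different from, the origin is
a closed curve that winds once around the origin. -/
def IsCenter (F : ℝ × ℝ → ℝ × ℝ) : Prop :=
  F 0 = 0 ∧ ∃ δ > 0, ∀ p : ℝ × ℝ, p ≠ 0 → ‖p‖ < δ →
    ∃ T > 0, ∃ (γ : ℝ → ℝ × ℝ) (r θ : ℝ → ℝ), γ 0 = p ∧
      IsIntegralCurveOn γ (fun _ => F) (Set.Icc 0 T) ∧ IsPolarOn γ r θ (Set.Icc 0 T) ∧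
      r T = r 0 ∧ |θ T - θ 0| = 2 * Real.pi

/-- The origin is a stable focus: along every solution that starts close to, and different from,
the origin, `r(t) → 0` and `|θ(t)| → ∞` as `t → ∞`. -/
def IsStableFocus (F : ℝ × ℝ → ℝ × ℝ) : Prop :=
  F 0 = 0 ∧ ∃ δ > 0, ∀ p : ℝ × ℝ, p ≠ 0 → ‖p‖ < δ →
    ∃ (γ : ℝ → ℝ × ℝ) (r θ : ℝ → ℝ), γ 0 = p ∧
      IsIntegralCurveOn γ (fun _ => F) (Set.Ici 0) ∧ IsPolarOn γ r θ (Set.Ici 0) ∧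
      Filter.Tendsto r Filter.atTop (nhds 0) ∧
      Filter.Tendsto (fun t => |θ t|) Filter.atTop Filter.atTop

/-- The origin is a focus: a stable one, or an unstable one (stable after reversal of time). -/
def IsFocus (F : ℝ × ℝ → ℝ × ℝ) : Prop :=
  IsStableFocus F ∨ IsStableFocus (fun p => -F p)

/-- `P` is the Poincare (first return) map at the origin along the line `{s • v}`: for small
`s ≠ 0` the orbit that starts at `s • v` meets the open half-line from the origin through `s • v`
again, for the first time, at `P s • v`. -/
def IsPoincareMap (F : ℝ × ℝ → ℝ × ℝ) (v : ℝ × ℝ) (P : ℝ → ℝ) : Prop :=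
  P 0 = 0 ∧ ∃ ε > 0, ∀ s : ℝ, s ≠ 0 → |s| < ε →
    ∃ T > 0, ∃ γ : ℝ → ℝ × ℝ, IsIntegralCurveOn γ (fun _ => F) (Set.Icc 0 T) ∧
      γ 0 = s • v ∧ γ T = P s • v ∧ 0 < s * P s ∧
      ∀ t ∈ Set.Ioo 0 T, ∀ c : ℝ, 0 < s * c → γ t ≠ c • v

/-- `l` is the Liapunov number of the origin with respect to the section `{s • v}`: the Poincare
map `P` is analytic at `0`, `P' 0 = 1`, and the displacement function `d s = P s - s` satisfies
`d''' 0 = l`. -/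
def IsLiapunovNumber (F : ℝ × ℝ → ℝ × ℝ) (v : ℝ × ℝ) (l : ℝ) : Prop :=
  ∃ P : ℝ → ℝ, IsPoincareMap F v P ∧ AnalyticAt ℝ P 0 ∧ deriv P 0 = 1 ∧
    iteratedDeriv 3 (fun s => P s - s) 0 = l

/-- The explicit generalized Liapunov number, as an expression in the boundary coefficients of the
two graphs and the entries of the linear part. -/
noncomputable def generalizedLiapunov {V₁ V₂ : Type*} [Fintype V₁] [DecidableEq V₁] [Fintype V₂]
    [DecidableEq V₂] (G₁ : SimpleGraph V₁) [DecidableRel G₁.Adj] (G₂ : SimpleGraph V₂)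
    [DecidableRel G₂.Adj] (a₁ a₂ a₃ a₄ : ℝ) : ℝ :=
  -(3 * Real.pi) / (2 * a₂ * (a₁ * a₄ - a₂ * a₃) ^ (3 / 2 : ℝ)) *
    ((a₁ * a₃ * ((G₁.boundaryCoeff 1 1 : ℝ) ^ 2 + G₁.boundaryCoeff 1 1 * G₂.boundaryCoeff 0 2
          + G₁.boundaryCoeff 0 2 * G₂.boundaryCoeff 1 1)
        + a₁ * a₂ * (G₂.boundaryCoeff 1 1 : ℝ) ^ 2
        + a₃ ^ 2 * (G₁.boundaryCoeff 1 1 * G₁.boundaryCoeff 0 2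
          + 2 * G₁.boundaryCoeff 0 2 * G₂.boundaryCoeff 0 2)
        - 2 * a₁ * a₃ * (G₂.boundaryCoeff 0 2 : ℝ) ^ 2
        + (a₂ * a₃ - 2 * a₁ ^ 2) * (G₂.boundaryCoeff 1 1 * G₂.boundaryCoeff 0 2))
      - (a₁ ^ 2 + a₂ * a₃) *
        (3 * a₃ * G₂.boundaryCoeff 0 3
          + 2 * a₁ * (G₁.boundaryCoeff 2 1 + G₂.boundaryCoeff 1 2)
          + (a₃ * G₁.boundaryCoeff 1 2 - a₂ * G₂.boundaryCoeff 2 1)))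

/-! In the coordinates `ξ = x`, `η = -(a₁ x + a₂ y) / w` with `w = √σ` the linear part is a rotation
of speed `w`. A vertex set that is nonempty contributes a term of degree at least two, because no
vertex is isolated, so in polar coordinates of the `(ξ, η)`-plane the system reads `r' = r² A(r,
θ)`, `θ' = w + r C(r, θ)`, with `A`, `C` polynomial in `r` and trigonometric in `θ`.

Eliminating time gives `dr/dθ = r² A / (w + r C)`. For the solution with `r = s` at `θ = 0`, write
`r = s u`; then `u = 1 + s ∫ u² A(su, θ) / (w + su C(su, θ)) dθ`, an equation in the Banach algebra
of continuous functions on `[0, 2π]`. The analytic inverse function theorem makes `u` analytic in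
`s` (`exists_radial_solutions`), so the return map is `P(s) = s + s² W(s)` with `W` analytic, and
`d'''(0) = 6 W'(0)`. With `A = A₀ + r A₁ + …` and `C = C₀ + …`, `W'(0) = ∫ (A₁/w - A₀ C₀/w²) + (∫
A₀/w)²`. The last integral vanishes, being that of a cubic trigonometric form; the others give the
explicit formula (`boundaryField_isPolarField`).

The zeros of an analytic function give the dichotomy (`IsPolarField.exists_displacement`). Either
`W` vanishes near `0` and all nearby orbits close up, or `W` has constant sign on some `(0, ε)` and
iterates of `P`, or of a right inverse of `P`, decrease to `0`, so that orbits spiral in, possibly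
in reversed time. If `W'(0) ≠ 0`, the first case is impossible. Orbits are built by concatenating
solutions over single turns (`exists_glued_solution`) and recovering time from the angular speed
(`exists_solution_of_speed_bounds`); uniqueness for the differential equation is never needed. -/

open Set Filter Topology

/-! ### Analytic dependence of the radial solution on its initial value -/

/-- An equation `u = e + s • K (s, u)` with analytic right-hand side has an analytic solution branch
through `u 0 = e`. -/
theorem exists_analyticAt_eq_add_smul {E : Type*} [NormedAddCommGroup E] [NormedSpace ℝ E]
    [CompleteSpace E] {K : ℝ × E → E} {e : E} (hK : AnalyticAt ℝ K (0, e)) :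
    ∃ u : ℝ → E, AnalyticAt ℝ u 0 ∧ u 0 = e ∧ ∀ᶠ s in 𝓝 (0 : ℝ), u s = e + s • K (s, u s) := by
  set Ψ : ℝ × E → ℝ × E := fun p => (p.1, p.2 - e - p.1 • K p) with hΨ
  have hΨa : AnalyticAt ℝ Ψ (0, e) := by
    have : AnalyticAt ℝ (fun p : ℝ × E => p.2 - e - p.1 • K p) (0, e) :=
      (analyticAt_snd.sub analyticAt_const).sub (analyticAt_fst.smul hK)
    exact analyticAt_fst.prod this
  -- At `(0, e)` the factor `s` removes the derivative of `K`, so the derivative of `Ψ` is the shear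
  -- `(σ, v) ↦ (σ, v - σ • K (0, e))`, which is always invertible.
  let f' : (ℝ × E) ≃L[ℝ] (ℝ × E) :=
    (ContinuousLinearEquiv.refl ℝ ℝ).skewProd (ContinuousLinearEquiv.refl ℝ E)
      (-(ContinuousLinearMap.toSpanSingleton ℝ (K (0, e))))
  have hf' : HasFDerivAt Ψ (f' : (ℝ × E) →L[ℝ] (ℝ × E)) (0, e) := by
    have h1 : HasFDerivAt (fun p : ℝ × E => p.1 • K p) _ (0, e) :=
      HasFDerivAt.fun_smul (hasFDerivAt_fst) hK.differentiableAt.hasFDerivAt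
    have h2 := (((hasFDerivAt_snd (𝕜 := ℝ) (E := ℝ) (F := E) (p := (0, e))).sub_const e).fun_sub h1)
    have h3 := (hasFDerivAt_fst (𝕜 := ℝ) (E := ℝ) (F := E) (p := (0, e))).prodMk h2
    refine h3.congr_fderiv ?_
    ext <;> simp [f', ContinuousLinearEquiv.skewProd_apply]
  -- The exponent `⊤` means analytic, so the local inverse is analytic and not merely smooth.
  have hc : ContDiffAt ℝ ⊤ Ψ (0, e) := hΨa.contDiffAt
  have hn : (⊤ : WithTop ℕ∞) ≠ 0 := by simp
  have hΨ0 : Ψ (0, e) = (0, 0) := by simp [hΨ]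
  have hloc := hc.to_localInverse hf' hn
  have hri := (hc.hasStrictFDerivAt' hf' hn).eventually_right_inverse
  have himg := hc.localInverse_apply_image hf' hn
  set g := hc.localInverse hf' hn with hg
  rw [hΨ0] at hloc hri himg
  have hga : AnalyticAt ℝ g (0, 0) :=
    analyticWithinAt_univ.1 (contDiffWithinAt_omega_iff_analyticWithinAt.1
      (contDiffWithinAt_univ.2 hloc))
  have hι : AnalyticAt ℝ (fun s : ℝ => ((s, 0) : ℝ × E)) 0 := analyticAt_id.prod analyticAt_const
  refine ⟨fun s => (g (s, 0)).2, ?_, ?_, ?_⟩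
  · exact analyticAt_snd.comp (hga.comp_of_eq hι rfl)
  · simp [himg]
  · have hev : ∀ᶠ s in 𝓝 (0 : ℝ), Ψ (g (s, 0)) = (s, 0) := by
      have := hι.continuousAt.tendsto.eventually hri
      exact this
    filter_upwards [hev] with s hs
    simp only [hΨ, Prod.mk.injEq] at hs
    obtain ⟨h1, h2⟩ := hs
    have h3 : g (s, 0) = (s, (g (s, 0)).2) := Prod.ext h1 rfl
    rw [h1, sub_sub, sub_eq_zero] at h2
    rw [← h3]
    exact h2

/-- The sum `∑ i, r ^ d i * α i θ`: a polynomial in `r` with coefficients depending on `θ`. -/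
def angularSum {ι : Type*} [Fintype ι] (d : ι → ℕ) (α : ι → ℝ → ℝ) (r θ : ℝ) : ℝ :=
  ∑ i, r ^ d i * α i θ

theorem angularSum_zero {ι : Type*} [Fintype ι] (d : ι → ℕ) (α : ι → ℝ → ℝ) (θ : ℝ) :
    angularSum d α 0 θ = ∑ i with d i = 0, α i θ := by
  rw [angularSum, Finset.sum_filter]
  refine Finset.sum_congr rfl fun i _ => ?_
  by_cases h : d i = 0 <;> simp [h]

theorem hasDerivAt_angularSum {ι : Type*} [Fintype ι] (d : ι → ℕ) (α : ι → ℝ → ℝ) (θ : ℝ)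
    {ρ : ℝ → ℝ} {ρ' t : ℝ} (hρ : HasDerivAt ρ ρ' t) (h0 : ρ t = 0) :
    HasDerivAt (fun s => angularSum d α (ρ s) θ) (ρ' * ∑ i with d i = 1, α i θ) t := by
  have h : HasDerivAt (fun s => ∑ i, ρ s ^ d i * α i θ)
      (∑ i, ((d i : ℝ) * ρ t ^ (d i - 1) * ρ') * α i θ) t :=
    HasDerivAt.fun_sum fun i _ => (hρ.pow (d i)).mul_const _
  refine h.congr_deriv ?_
  rw [Finset.sum_filter, Finset.mul_sum]
  refine Finset.sum_congr rfl fun i _ => ?_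
  rw [h0]
  obtain h | h | h : d i = 0 ∨ d i = 1 ∨ 2 ≤ d i := by omega
  · simp [h]
  · simp [h]
  · have : d i - 1 ≠ 0 := by omega
    have h' : d i ≠ 1 := by omega
    simp [this, h']

theorem continuous_angularSum {ι : Type*} [Fintype ι] {d : ι → ℕ} {α : ι → ℝ → ℝ}
    (hα : ∀ i, Continuous (α i)) : Continuous fun p : ℝ × ℝ => angularSum d α p.1 p.2 := by
  unfold angularSum
  fun_prop

/-- Integration from the left end point, as a continuous linear map on `C([0, L])`. -/
noncomputable def primitiveCLM {L : ℝ} (hL : 0 ≤ L) : C(Icc 0 L, ℝ) →L[ℝ] C(Icc 0 L, ℝ) :=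
  LinearMap.mkContinuous
    { toFun := fun f => ⟨fun θ => ∫ x in (0 : ℝ)..θ, IccExtend hL f x,
        (intervalIntegral.continuous_primitive
          (fun a b => (f.continuous.Icc_extend' (h := hL)).intervalIntegrable a b) 0).comp
          continuous_subtype_val⟩
      map_add' := fun f g => by
        ext θ
        simp only [ContinuousMap.coe_mk, ContinuousMap.add_apply]
        rw [← intervalIntegral.integral_add
          ((f.continuous.Icc_extend' (h := hL)).intervalIntegrable _ _)
          ((g.continuous.Icc_extend' (h := hL)).intervalIntegrable _ _)]
        rfl
      map_smul' := fun c f => by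
        ext θ
        simp only [ContinuousMap.coe_mk, ContinuousMap.smul_apply, RingHom.id_apply, smul_eq_mul]
        rw [← intervalIntegral.integral_const_mul]
        rfl } L fun f => by
    refine (ContinuousMap.norm_le _ (by positivity)).2 fun θ => ?_
    have := intervalIntegral.norm_integral_le_of_norm_le_const (a := 0) (b := (θ : ℝ))
      (f := IccExtend hL f) (C := ‖f‖) fun x _ => f.norm_coe_le_norm _
    refine this.trans ?_
    rw [sub_zero, abs_of_nonneg θ.2.1, mul_comm]
    exact mul_le_mul_of_nonneg_right θ.2.2 (norm_nonneg _)

theorem primitiveCLM_apply {L : ℝ} (hL : 0 ≤ L) (f : C(Icc 0 L, ℝ)) (θ : Icc 0 L) :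
    primitiveCLM hL f θ = ∫ x in (0 : ℝ)..θ, IccExtend hL f x := rfl

/-- The family of solutions, with `r = s * u`, of the periodic equation
`r' = r ^ 2 * A (r, θ) / (w + r * C (r, θ))` that start at `r = s`, and its
first return expansion. -/
theorem exists_radial_solutions {ι : Type*} [Fintype ι] (d : ι → ℕ) {α β : ι → ℝ → ℝ}
    (hα : ∀ i, Continuous (α i)) (hβ : ∀ i, Continuous (β i)) {w L : ℝ} (hw : 0 < w) (hL : 0 < L) :
    ∃ (u : ℝ → ℝ → ℝ) (W : ℝ → ℝ), AnalyticAt ℝ W 0 ∧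
      HasDerivAt W ((∫ θ in (0 : ℝ)..L, ((∑ i with d i = 1, α i θ) / w -
        angularSum d α 0 θ * angularSum d β 0 θ / w ^ 2)) +
        (∫ θ in (0 : ℝ)..L, angularSum d α 0 θ / w) ^ 2) 0 ∧
      ∀ᶠ s in 𝓝 (0 : ℝ), u s 0 = 1 ∧ u s L = 1 + s * W s ∧ ∀ θ ∈ Icc 0 L,
        ContinuousAt (fun s => u s θ) s ∧ 1 / 2 ≤ u s θ ∧ u s θ ≤ 2 ∧
        w / 2 ≤ w + s * u s θ * angularSum d β (s * u s θ) θ ∧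
        w + s * u s θ * angularSum d β (s * u s θ) θ ≤ 2 * w ∧
        HasDerivWithinAt (u s) (s * (u s θ ^ 2 * angularSum d α (s * u s θ) θ /
          (w + s * u s θ * angularSum d β (s * u s θ) θ))) (Icc 0 L) θ := by
  have hL0 := hL.le
  let αc : ι → C(Icc 0 L, ℝ) := fun i => ⟨fun θ => α i θ, (hα i).comp continuous_subtype_val⟩
  let βc : ι → C(Icc 0 L, ℝ) := fun i => ⟨fun θ => β i θ, (hβ i).comp continuous_subtype_val⟩
  let D : ℝ × C(Icc 0 L, ℝ) → C(Icc 0 L, ℝ) := fun p =>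
    w • (1 : C(Icc 0 L, ℝ)) + (p.1 • p.2) * ∑ i, (p.1 • p.2) ^ d i * βc i
  -- `Ring.inverse` is analytic at units of the Banach algebra, and `D (0, 1)` is the nonzero
  -- constant `w`.
  let H : ℝ × C(Icc 0 L, ℝ) → C(Icc 0 L, ℝ) := fun p =>
    p.2 ^ 2 * (∑ i, (p.1 • p.2) ^ d i * αc i) * Ring.inverse (D p)
  let J := primitiveCLM hL0
  have hsu (p : ℝ × C(Icc 0 L, ℝ)) : AnalyticAt ℝ (fun p : ℝ × C(Icc 0 L, ℝ) => p.1 • p.2) p :=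
    analyticAt_fst.smul analyticAt_snd
  have hDa (p) : AnalyticAt ℝ D p := by
    refine analyticAt_const.add ((hsu p).mul ?_)
    exact Finset.analyticAt_fun_sum _ fun i _ => ((hsu p).pow _).mul analyticAt_const
  have hD0 : D (0, 1) = w • 1 := by simp [D]
  let U : (C(Icc 0 L, ℝ))ˣ := ⟨w • 1, w⁻¹ • 1, by simp [smul_smul, hw.ne'], by
    simp [smul_smul, hw.ne']⟩
  have hUD : D (0, 1) = (U : C(Icc 0 L, ℝ)) := hD0
  have hHa : AnalyticAt ℝ H (0, 1) := by
    refine ((analyticAt_snd.pow 2).mul ?_).mul ?_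
    · exact Finset.analyticAt_fun_sum _ fun i _ => ((hsu _).pow _).mul analyticAt_const
    · exact (analyticAt_inverse U).comp_of_eq (hDa _) hUD
  -- This fixed point equation is the integrated radial equation for `u = r / s`.
  obtain ⟨u, hua, hu0, hu⟩ := exists_analyticAt_eq_add_smul (K := fun p => J (H p)) (e := 1)
    ((J.analyticAt _).comp hHa)
  have hDapp (s : ℝ) (f : C(Icc 0 L, ℝ)) (θ : Icc 0 L) :
      D (s, f) θ = w + s * f θ * angularSum d β (s * f θ) θ := by
    simp [D, angularSum, βc, mul_assoc]
  have hHapp (s : ℝ) (f : C(Icc 0 L, ℝ)) (θ : Icc 0 L) (h : IsUnit (D (s, f))) :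
      H (s, f) θ = f θ ^ 2 * angularSum d α (s * f θ) θ /
        (w + s * f θ * angularSum d β (s * f θ) θ) := by
    have h1 := DFunLike.congr_fun (Ring.mul_inverse_cancel _ h) θ
    simp only [ContinuousMap.mul_apply, ContinuousMap.one_apply, hDapp] at h1
    have h2 : w + s * f θ * angularSum d β (s * f θ) θ ≠ 0 := left_ne_zero_of_mul_eq_one h1
    rw [eq_div_iff h2]
    simp only [H, ContinuousMap.mul_apply]
    rw [mul_assoc, mul_comm (Ring.inverse (D (s, f)) θ), h1]
    simp [angularSum, αc]
  have hcurve : AnalyticAt ℝ (fun s => (s, u s)) 0 := analyticAt_id.prod hua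
  have hHs : AnalyticAt ℝ (fun s => H (s, u s)) 0 :=
    hHa.comp_of_eq hcurve (by simp [hu0])
  have hDs : AnalyticAt ℝ (fun s => D (s, u s)) 0 := (hDa _).comp hcurve
  have hDsu : ∀ᶠ s in 𝓝 (0 : ℝ), IsUnit (D (s, u s)) := by
    have : {x : C(Icc 0 L, ℝ) | IsUnit x} ∈ 𝓝 (D (0, u 0)) := by
      rw [hu0, hUD]
      exact Units.nhds U
    exact hDs.continuousAt.tendsto this
  have hucl : ∀ᶠ s in 𝓝 (0 : ℝ), ‖u s - 1‖ < 1 / 2 := by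
    have := hua.continuousAt.tendsto
    rw [hu0] at this
    simpa [dist_eq_norm] using (Metric.tendsto_nhds.1 this) (1 / 2) (by norm_num)
  have hDcl : ∀ᶠ s in 𝓝 (0 : ℝ), ‖D (s, u s) - w • 1‖ < w / 2 := by
    have := hDs.continuousAt.tendsto
    rw [hu0, hD0] at this
    simpa [dist_eq_norm] using (Metric.tendsto_nhds.1 this) (w / 2) (by positivity)
  let l : Icc 0 L := ⟨L, hL0, le_rfl⟩
  let ev : C(Icc 0 L, ℝ) →L[ℝ] ℝ := ContinuousMap.evalCLM ℝ l
  have hWa : AnalyticAt ℝ (fun s => J (H (s, u s)) l) 0 :=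
    ((ev.comp J).analyticAt _).comp hHs
  -- Evaluating the fixed point equation at `θ = L` shows that `W s` must be the integral of `H (s,
  -- u s)` over the full turn. `projIcc` only extends `u s` beyond `[0, L]`.
  refine ⟨fun s θ => u s (projIcc 0 L hL0 θ), fun s => J (H (s, u s)) l, hWa, ?_, ?_⟩
  · obtain ⟨u', hu'⟩ : ∃ u', HasDerivAt u u' 0 := ⟨_, hua.differentiableAt.hasDerivAt⟩
    obtain ⟨H', hH'⟩ : ∃ H', HasDerivAt (fun s => H (s, u s)) H' 0 :=
      ⟨_, hHs.differentiableAt.hasDerivAt⟩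
    have hunit0 : IsUnit (D (0, 1)) := hUD ▸ U.isUnit
    have hJ0 (θ : Icc 0 L) : J (H (0, 1)) θ =
        ∫ x in (0 : ℝ)..θ, angularSum d α 0 x / w := by
      rw [primitiveCLM_apply]
      refine intervalIntegral.integral_congr fun x hx => ?_
      rw [uIcc_of_le θ.2.1] at hx
      have hx' : x ∈ Icc 0 L := ⟨hx.1, hx.2.trans θ.2.2⟩
      simp only [IccExtend_of_mem _ _ hx']
      rw [hHapp _ _ _ hunit0]
      simp
    have hu'e : u' = J (H (0, 1)) := by
      have h1 : HasDerivAt (fun s => (1 : C(Icc 0 L, ℝ)) + s • J (H (s, u s)))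
          ((0 : ℝ) • J H' + (1 : ℝ) • J (H (0, u 0))) 0 :=
        ((hasDerivAt_id (0 : ℝ)).smul (J.hasFDerivAt.comp_hasDerivAt 0 hH')).const_add 1
      have := (hu'.congr_of_eventuallyEq (hu.mono fun s hs => hs.symm)).unique h1
      simpa [hu0] using this
    have hev (θ : Icc 0 L) {f : ℝ → C(Icc 0 L, ℝ)} {f'} (hf : HasDerivAt f f' 0) :
        HasDerivAt (fun s => f s θ) (f' θ) 0 :=
      (ContinuousMap.evalCLM ℝ θ : C(Icc 0 L, ℝ) →L[ℝ] ℝ).hasFDerivAt.comp_hasDerivAt 0 hf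
    have hH'e (θ : Icc 0 L) : H' θ = (∑ i with d i = 1, α i θ) / w -
        angularSum d α 0 θ * angularSum d β 0 θ / w ^ 2 +
        2 * (angularSum d α 0 θ / w) * ∫ x in (0 : ℝ)..θ, angularSum d α 0 x / w := by
      have h1 := hev θ hH'
      have hUθ := hev θ hu'
      have hρ : HasDerivAt (fun s => s * u s θ) 1 0 := by
        simpa [hu0] using (hasDerivAt_id' (0 : ℝ)).fun_mul hUθ
      have hA := hasDerivAt_angularSum d α θ hρ (by simp)
      have hC := hasDerivAt_angularSum d β θ hρ (by simp)
      have hden := (hρ.mul hC).const_add w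
      have h2 := ((hUθ.pow 2).mul hA).div hden (by simpa using hw.ne')
      have h3 := (h1.congr_of_eventuallyEq (f₁ := fun s =>
        u s θ ^ 2 * angularSum d α (s * u s θ) θ /
        (w + s * u s θ * angularSum d β (s * u s θ) θ))
        (hDsu.mono fun s hs => (hHapp s (u s) θ hs).symm)).unique h2
      rw [h3, ← hJ0, ← hu'e]
      simp [hu0]
      field_simp
      ring
    have hW' : HasDerivAt (fun s => J (H (s, u s)) l) (J H' l) 0 :=
      hev l (J.hasFDerivAt.comp_hasDerivAt 0 hH')
    refine hW'.congr_deriv ?_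
    have hα0 : Continuous fun x => angularSum d α 0 x / w :=
      ((continuous_angularSum hα).comp (continuous_const.prodMk continuous_id)).div_const w
    have hβ0 : Continuous fun x => angularSum d β 0 x :=
      (continuous_angularSum hβ).comp (continuous_const.prodMk continuous_id)
    have hα0' : Continuous fun x => angularSum d α 0 x :=
      (continuous_angularSum hα).comp (continuous_const.prodMk continuous_id)
    set p : ℝ → ℝ := fun θ => ∫ x in (0 : ℝ)..θ, angularSum d α 0 x / w with hp
    have hpd (θ : ℝ) : HasDerivAt p (angularSum d α 0 θ / w) θ :=
      intervalIntegral.integral_hasDerivAt_right (hα0.intervalIntegrable _ _)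
        (hα0.stronglyMeasurableAtFilter _ _) hα0.continuousAt
    have hpc : Continuous p := continuous_iff_continuousAt.2 fun θ => (hpd θ).continuousAt
    -- The contribution of `u'(0) = p` to `W'(0)` is the integral of `(p²)'`; this is the source of
    -- the squared term.
    have hsq : ∫ θ in (0 : ℝ)..L, 2 * (angularSum d α 0 θ / w) * p θ = p L ^ 2 := by
      have := intervalIntegral.integral_eq_sub_of_hasDerivAt (a := 0) (b := L)
        (f := fun θ => p θ ^ 2) (f' := fun θ => 2 * (angularSum d α 0 θ / w) * p θ)
        (fun θ _ => ((hpd θ).pow 2).congr_deriv (by simp; ring))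
        (((continuous_const.mul hα0).mul hpc).intervalIntegrable _ _)
      rw [this]
      simp [hp]
    rw [primitiveCLM_apply, ← hsq, ← intervalIntegral.integral_add]
    · refine intervalIntegral.integral_congr fun x hx => ?_
      rw [uIcc_of_le hL0] at hx
      simp only [IccExtend_of_mem _ _ hx]
      rw [hH'e]
    · refine Continuous.intervalIntegrable ?_ _ _
      refine Continuous.sub ?_ ((hα0'.mul hβ0).div_const _)
      exact (continuous_finsetSum _ fun i _ => hα i).div_const w
    · exact ((continuous_const.mul hα0).mul hpc).intervalIntegrable _ _
  · filter_upwards [hu, hDsu, hucl, hDcl, hua.eventually_analyticAt] with s h1 h2 h3 h4 h5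
    have hext (x : ℝ) : u s (projIcc 0 L hL0 x) =
        1 + s * ∫ y in (0 : ℝ)..(projIcc 0 L hL0 x), IccExtend hL0 (H (s, u s)) y := by
      conv_lhs => rw [h1]
      simp only [ContinuousMap.add_apply, ContinuousMap.one_apply, ContinuousMap.smul_apply,
        smul_eq_mul]
      rfl
    refine ⟨?_, ?_, fun θ hθ => ⟨?_, ?_⟩⟩
    · rw [hext]
      simp
    · have : projIcc 0 L hL0 L = l := projIcc_right _
      simp only [this]
      conv_lhs => rw [h1]
      simp
    · exact (ContinuousMap.evalCLM ℝ (projIcc 0 L hL0 θ) :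
        C(Icc 0 L, ℝ) →L[ℝ] ℝ).continuous.continuousAt.comp h5.continuousAt
    · simp only [projIcc_of_mem hL0 hθ]
      have h6 := ((u s - 1).norm_coe_le_norm ⟨θ, hθ⟩).trans h3.le
      have h7 := ((D (s, u s) - w • 1).norm_coe_le_norm ⟨θ, hθ⟩).trans h4.le
      simp only [ContinuousMap.sub_apply, ContinuousMap.one_apply, Real.norm_eq_abs, hDapp,
        ContinuousMap.smul_apply, smul_eq_mul, mul_one, abs_le] at h6 h7
      refine ⟨by linarith, by linarith, by linarith, by linarith, ?_⟩
      rw [← hHapp _ _ ⟨θ, hθ⟩ h2]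
      have hcont : Continuous (IccExtend hL0 (H (s, u s))) :=
        (H (s, u s)).continuous.Icc_extend'
      have h8 : HasDerivAt (fun x => 1 + s * ∫ y in (0 : ℝ)..x, IccExtend hL0 (H (s, u s)) y)
          (s * IccExtend hL0 (H (s, u s)) θ) θ :=
        ((intervalIntegral.integral_hasDerivAt_right (hcont.intervalIntegrable _ _)
          (hcont.stronglyMeasurableAtFilter _ _) hcont.continuousAt).const_mul s).const_add 1
      rw [IccExtend_of_mem _ _ hθ] at h8
      refine h8.hasDerivWithinAt.congr (fun x hx => ?_) ?_
      · rw [hext, projIcc_of_mem hL0 hx]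
      · rw [hext, projIcc_of_mem hL0 hθ]

/-! ### Gluing successive turns and recovering time from the angle -/

/-- Solutions of a periodic scalar equation on `[0, L]` that fit together end to start are glued to
a solution on `[0, ∞)`. -/
theorem exists_glued_solution {L : ℝ} (hL : 0 < L) {R : ℝ → ℝ → ℝ}
    (hR : ∀ r θ, R r (θ + L) = R r θ) {f : ℕ → ℝ → ℝ}
    (hf : ∀ n, ∀ θ ∈ Icc 0 L, HasDerivWithinAt (f n) (R (f n θ) θ) (Icc 0 L) θ)
    (hfit : ∀ n, f n L = f (n + 1) 0) :
    ∃ g : ℝ → ℝ, (∀ n : ℕ, ∀ θ ∈ Icc 0 L, g (n * L + θ) = f n θ) ∧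
      ∀ θ ∈ Ici (0 : ℝ), HasDerivWithinAt g (R (g θ) θ) (Ici 0) θ := by
  have hRn (n : ℕ) (r θ : ℝ) : R r (n * L + θ) = R r θ := by
    induction n with
    | zero => simp
    | succ k ih =>
      rw [← ih, ← hR r (k * L + θ)]
      congr 1
      push_cast
      ring
  -- With the floor, a junction point belongs to the later piece; its value as the end point of the
  -- earlier piece comes from `hfit`.
  let g : ℝ → ℝ := fun x => f ⌊x / L⌋₊ (x - ⌊x / L⌋₊ * L)
  have hg (n : ℕ) (θ : ℝ) (hθ : θ ∈ Icc 0 L) : g (n * L + θ) = f n θ := by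
    rcases hθ.2.lt_or_eq with h | h
    · have : ⌊(n * L + θ) / L⌋₊ = n := by
        have := hθ.1
        rw [Nat.floor_eq_iff (by positivity), le_div_iff₀ hL, div_lt_iff₀ hL]
        exact ⟨by linarith, by linarith⟩
      simp [g, this]
    · subst h
      have : ⌊(n * θ + θ) / θ⌋₊ = n + 1 := by
        rw [add_div, mul_div_cancel_right₀ _ hL.ne', div_self hL.ne']
        exact_mod_cast Nat.floor_natCast (n + 1)
      simp only [g, this, hfit]
      congr 1
      push_cast
      ring
  have hg' (n : ℕ) (x : ℝ) (hx : x ∈ Icc (n * L) (n * L + L)) :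
      HasDerivWithinAt g (R (g x) x) (Icc (n * L) (n * L + L)) x := by
    have hy : x - n * L ∈ Icc 0 L := ⟨by linarith [hx.1], by linarith [hx.2]⟩
    have h1 : HasDerivWithinAt (fun x => x - n * L) 1 (Icc (n * L) (n * L + L)) x :=
      (hasDerivWithinAt_id x _).sub_const _
    have h2 := (hf n _ hy).comp x h1 (fun z (hz : z ∈ Icc (n * L) (n * L + L)) =>
      ⟨by linarith [hz.1], by linarith [hz.2]⟩)
    have hgx : ∀ z ∈ Icc (n * L) (n * L + L), g z = f n (z - n * L) := fun z hz => by
      rw [← hg n (z - n * L) ⟨by linarith [hz.1], by linarith [hz.2]⟩]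
      congr 1
      ring
    refine (h2.congr hgx (hgx x hx)).congr_deriv ?_
    rw [hgx x hx, mul_one, ← hRn n _ (x - n * L)]
    congr 1
    ring
  refine ⟨g, hg, fun x (hx : 0 ≤ x) => ?_⟩
  have hright : HasDerivWithinAt g (R (g x) x) (Ici x) x := by
    have h1 : (⌊x / L⌋₊ : ℝ) * L ≤ x := (le_div_iff₀ hL).1 (Nat.floor_le (by positivity))
    have h2 : x < ⌊x / L⌋₊ * L + L := by
      have := (div_lt_iff₀ hL).1 (Nat.lt_floor_add_one (x / L))
      linarith
    exact ((hg' _ x ⟨h1, h2.le⟩).mono (Icc_subset_Icc_left h1)).mono_of_mem_nhdsWithin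
      (Icc_mem_nhdsGE h2)
  rcases hx.lt_or_eq with h | h
  -- For the left derivative the block must be `(nL, nL + L]`, hence the ceiling less one in place
  -- of the floor.
  · obtain ⟨n, h1, h2⟩ : ∃ n : ℕ, n * L < x ∧ x ≤ n * L + L := by
      refine ⟨⌈x / L⌉₊ - 1, ?_⟩
      have h3 : 1 ≤ ⌈x / L⌉₊ := Nat.one_le_ceil_iff.2 (by positivity)
      rw [Nat.cast_sub h3, Nat.cast_one]
      have h4 := Nat.ceil_lt_add_one (a := x / L) (by positivity)
      have h5 := Nat.le_ceil (x / L)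
      rw [div_le_iff₀ hL] at h5
      have h6 := (lt_div_iff₀ hL).1 (show (⌈x / L⌉₊ : ℝ) - 1 < x / L by linarith)
      exact ⟨h6, by linarith⟩
    have hleft : HasDerivWithinAt g (R (g x) x) (Iic x) x :=
      ((hg' n x ⟨h1.le, h2⟩).mono (Icc_subset_Icc_right h2)).mono_of_mem_nhdsWithin
        (Icc_mem_nhdsLE h1)
    have := hleft.union hright
    rw [Iic_union_Ici, hasDerivWithinAt_univ] at this
    exact this.hasDerivWithinAt
  · rw [← h] at hright ⊢
    exact hright

/-- An autonomous scalar equation `Θ' = g Θ` with continuous speed between two positive bounds has a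
global increasing solution onto the line. -/
theorem exists_solution_of_speed_bounds {g : ℝ → ℝ} (hg : Continuous g) {c C : ℝ} (hc : 0 < c)
    (hcg : ∀ x, c ≤ g x) (hgC : ∀ x, g x ≤ C) (x₀ : ℝ) :
    ∃ Θ : ℝ → ℝ, Θ 0 = x₀ ∧ (∀ t, HasDerivAt Θ (g (Θ t)) t) ∧ StrictMono Θ ∧
      Function.Surjective Θ := by
  have hg0 (x) : 0 < g x := hc.trans_le (hcg x)
  have hC : 0 < C := (hg0 0).trans_le (hgC 0)
  have hgi : Continuous fun x => (g x)⁻¹ := hg.inv₀ fun x => (hg0 x).ne'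
  -- `τ x` is the time at which the angle reaches `x`, and `Θ` is its inverse. The bound `g ≤ C`
  -- gives `τ' ≥ 1 / C`, which makes `τ` onto.
  let τ : ℝ → ℝ := fun x => ∫ y in x₀..x, (g y)⁻¹
  have hτ (x : ℝ) : HasDerivAt τ (g x)⁻¹ x :=
    intervalIntegral.integral_hasDerivAt_right (hgi.intervalIntegrable _ _)
      (hgi.stronglyMeasurableAtFilter _ _) hgi.continuousAt
  have hτc : Continuous τ := continuous_iff_continuousAt.2 fun x => (hτ x).continuousAt
  have hmono : StrictMono τ := strictMono_of_hasDerivAt_pos hτ fun x => inv_pos.2 (hg0 x)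
  have hgrow : Monotone fun x => τ x - C⁻¹ * x := by
    refine monotone_of_hasDerivAt_nonneg (fun x => (hτ x).sub ((hasDerivAt_id x).const_mul C⁻¹))
      fun x => ?_
    have := inv_anti₀ (hg0 x) (hgC x)
    simpa using this
  have hlin : Tendsto (fun x => C⁻¹ * x + (τ 0)) atTop atTop :=
    tendsto_atTop_add_const_right _ _ (tendsto_id.const_mul_atTop (inv_pos.2 hC))
  have hlin' : Tendsto (fun x => C⁻¹ * x + (τ 0)) atBot atBot :=
    tendsto_atBot_add_const_right _ _ (tendsto_id.const_mul_atBot (inv_pos.2 hC))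
  have htop : Tendsto τ atTop atTop := by
    refine tendsto_atTop_mono' _ ?_ hlin
    filter_upwards [eventually_ge_atTop 0] with x hx
    have := hgrow hx
    simp only [mul_zero] at this
    linarith
  have hbot : Tendsto τ atBot atBot := by
    refine tendsto_atBot_mono' _ ?_ hlin'
    filter_upwards [eventually_le_atBot 0] with x hx
    have := hgrow hx
    simp only [mul_zero] at this
    linarith
  let e := hmono.orderIsoOfSurjective τ (hτc.surjective htop hbot)
  have he (x : ℝ) : e x = τ x := rfl
  have hes (t : ℝ) : τ (e.symm t) = t := e.apply_symm_apply t
  refine ⟨e.symm, ?_, fun t => ?_, e.symm.strictMono, e.symm.surjective⟩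
  · rw [← e.symm_apply_apply x₀, he]
    simp [τ]
  · have := (hτ (e.symm t)).of_local_left_inverse (e.symm.continuous.continuousAt (x := t))
      (inv_ne_zero (hg0 _).ne') (Eventually.of_forall hes)
    rwa [inv_inv] at this

/-! ### Polar coordinates along an ellipse -/

/-- After factoring out `α * exp (θ * I)`, the remaining factor `q θ` stays in the open unit disc
around `1`. Its principal argument is therefore continuous, bounded and periodic, and the winding
comes from `exp (θ * I)` alone. -/
theorem Complex.exists_polar_lift {α β : ℂ} (h : ‖β‖ < ‖α‖) :
    ∃ m ψ : ℝ → ℝ, Continuous m ∧ Continuous ψ ∧ (∀ θ, 0 < m θ) ∧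
      (∀ θ : ℝ, α * exp (θ * I) + β * exp (-θ * I) = m θ * exp (ψ θ * I)) ∧
      (∀ θ, m (θ + 2 * Real.pi) = m θ) ∧ (∀ θ, ψ (θ + 2 * Real.pi) = ψ θ + 2 * Real.pi) ∧
      (∃ M, ∀ θ, m θ ≤ M) ∧ ∃ M, ∀ θ, |ψ θ - θ| ≤ M := by
  have hα : α ≠ 0 := norm_pos_iff.1 ((norm_nonneg _).trans_lt h)
  let q : ℝ → ℂ := fun θ => 1 + β / α * exp (-(2 * θ) * I)
  have hexp (θ : ℝ) : ‖exp (-(2 * θ) * I)‖ = 1 := by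
    have := norm_exp_ofReal_mul_I (-(2 * θ))
    push_cast at this
    exact this
  have hnorm (θ : ℝ) : ‖β / α * exp (-(2 * θ) * I)‖ < 1 := by
    rw [norm_mul, hexp, mul_one, norm_div, div_lt_one (norm_pos_iff.2 hα)]
    exact h
  have hslit (θ : ℝ) : q θ ∈ slitPlane := by
    refine mem_slitPlane_iff.2 (Or.inl ?_)
    have h' := (abs_lt.1 ((abs_re_le_norm _).trans_lt (hnorm θ))).1
    simp only [q, add_re, one_re]
    linarith
  have hqc : Continuous q := by
    simp only [q]
    fun_prop
  have hq0 (θ : ℝ) : q θ ≠ 0 := slitPlane_ne_zero (hslit θ)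
  have hqper (θ : ℝ) : q (θ + 2 * Real.pi) = q θ := by
    have : -(2 * ((θ + 2 * Real.pi : ℝ) : ℂ)) * I =
        -(2 * θ) * I + ((-2 : ℤ) : ℂ) * (2 * Real.pi * I) := by
      push_cast
      ring
    simp only [q]
    rw [this, exp_add, exp_int_mul_two_pi_mul_I, mul_one]
  refine ⟨fun θ => ‖α‖ * ‖q θ‖, fun θ => α.arg + θ + (q θ).arg, by fun_prop, ?_, fun θ => ?_,
    fun θ => ?_, fun θ => by simp only [hqper], fun θ => by simp only [hqper]; ring,
    ⟨‖α‖ * 2, fun θ => ?_⟩, |α.arg| + Real.pi, fun θ => ?_⟩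
  · refine (continuous_const.add continuous_id).add (continuous_iff_continuousAt.2 fun θ => ?_)
    exact (continuousAt_arg (hslit θ)).comp hqc.continuousAt
  · have := norm_pos_iff.2 hα
    have := norm_pos_iff.2 (hq0 θ)
    positivity
  · have h1 : α * exp (θ * I) + β * exp (-θ * I) = α * q θ * exp (θ * I) := by
      have : exp (-θ * I) = exp (-(2 * θ) * I) * exp (θ * I) := by
        rw [← exp_add]
        congr 1
        ring
      rw [this]
      simp only [q]
      field_simp
    rw [h1]
    conv_lhs => rw [← norm_mul_exp_arg_mul_I α, ← norm_mul_exp_arg_mul_I (q θ)]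
    push_cast
    rw [add_mul, add_mul, exp_add, exp_add]
    ring
  · refine mul_le_mul_of_nonneg_left ?_ (norm_nonneg _)
    refine (norm_add_le _ _).trans ?_
    have := (hnorm θ).le
    rw [norm_one]
    linarith
  · have h1 := abs_arg_le_pi (q θ)
    calc |α.arg + θ + (q θ).arg - θ| = |α.arg + (q θ).arg| := by congr 1; ring
      _ ≤ _ := (abs_add_le _ _).trans (by linarith)

/-- The ellipse `cos θ • a + sin θ • b`. -/
noncomputable def ellipseMap (a b : ℝ × ℝ) (θ : ℝ) : ℝ × ℝ := Real.cos θ • a + Real.sin θ • b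

theorem hasDerivAt_ellipseMap (a b : ℝ × ℝ) (θ : ℝ) :
    HasDerivAt (ellipseMap a b) (ellipseMap b (-a) θ) θ := by
  refine (((Real.hasDerivAt_cos θ).smul_const a).add
    ((Real.hasDerivAt_sin θ).smul_const b)).congr_deriv ?_
  simp [ellipseMap, add_comm]

/-- Continuous polar coordinates along an ellipse around the origin. -/
theorem exists_polar_lift_ellipseMap {a b : ℝ × ℝ} (hab : a.1 * b.2 - a.2 * b.1 ≠ 0) :
    ∃ (m ψ : ℝ → ℝ) (ι : ℝ), (ι = 1 ∨ ι = -1) ∧ Continuous m ∧ Continuous ψ ∧ (∀ θ, 0 < m θ) ∧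
      (∀ θ, ellipseMap a b θ = (m θ * Real.cos (ψ θ), m θ * Real.sin (ψ θ))) ∧
      (∀ θ, m (θ + 2 * Real.pi) = m θ) ∧ (∀ θ, ψ (θ + 2 * Real.pi) = ψ θ + ι * (2 * Real.pi)) ∧
      (∃ M, ∀ θ, m θ ≤ M) ∧ ∃ M, ∀ θ, |ψ θ - ι * θ| ≤ M := by
  -- These are the complex-linear and conjugate-linear parts of the map sending `1, I` to `a, b`.
  -- Its determinant is `‖α‖² - ‖β‖²`; if it is negative, `θ ↦ -θ` exchanges the two parts and
  -- reverses the winding.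
  let α : ℂ := ⟨(a.1 + b.2) / 2, (a.2 - b.1) / 2⟩
  let β : ℂ := ⟨(a.1 - b.2) / 2, (a.2 + b.1) / 2⟩
  have hdet : ‖α‖ ^ 2 - ‖β‖ ^ 2 = a.1 * b.2 - a.2 * b.1 := by
    rw [← Complex.normSq_eq_norm_sq, ← Complex.normSq_eq_norm_sq]
    simp only [Complex.normSq_apply, α, β]
    ring
  have hre (θ : ℝ) : (α * Complex.exp (θ * Complex.I) + β * Complex.exp (-θ * Complex.I)) =
      ⟨(ellipseMap a b θ).1, (ellipseMap a b θ).2⟩ := by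
    have h1 : Complex.exp (θ * Complex.I) = ⟨Real.cos θ, Real.sin θ⟩ := by
      apply Complex.ext <;> simp
    have h2 : Complex.exp (-θ * Complex.I) = ⟨Real.cos θ, -Real.sin θ⟩ := by
      rw [show (-(θ : ℂ)) = ((-θ : ℝ) : ℂ) by push_cast; rfl]
      apply Complex.ext
      · rw [Complex.exp_ofReal_mul_I_re, Real.cos_neg]
      · rw [Complex.exp_ofReal_mul_I_im, Real.sin_neg]
    rw [h1, h2]
    apply Complex.ext <;> simp [α, β, ellipseMap] <;> ring
  have hpolar (m ψ x y : ℝ) (h : (⟨x, y⟩ : ℂ) = m * Complex.exp (ψ * Complex.I)) :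
      (x, y) = (m * Real.cos ψ, m * Real.sin ψ) := by
    have h1 := congrArg Complex.re h
    have h2 := congrArg Complex.im h
    simp only [Complex.re_ofReal_mul, Complex.im_ofReal_mul, Complex.exp_ofReal_mul_I_re,
      Complex.exp_ofReal_mul_I_im] at h1 h2
    rw [h1, h2]
  rcases lt_or_ge ‖β‖ ‖α‖ with h | h
  · obtain ⟨m, ψ, h1, h2, h3, h4, h5, h6, h7, h8⟩ := Complex.exists_polar_lift h
    refine ⟨m, ψ, 1, Or.inl rfl, h1, h2, h3, fun θ => ?_, h5, fun θ => by rw [h6, one_mul], h7,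
      by simpa using h8⟩
    exact hpolar _ _ (ellipseMap a b θ).1 (ellipseMap a b θ).2 (by rw [← h4, hre])
  · have h' : ‖α‖ < ‖β‖ := lt_of_le_of_ne h fun h => hab (by rw [← hdet, h, sub_self])
    obtain ⟨m, ψ, h1, h2, h3, h4, h5, h6, ⟨M, h7⟩, M', h8⟩ := Complex.exists_polar_lift h'
    refine ⟨fun θ => m (-θ), fun θ => ψ (-θ), -1, Or.inr rfl, h1.comp continuous_neg,
      h2.comp continuous_neg, fun θ => h3 _, fun θ => ?_, fun θ => ?_, fun θ => ?_,
      ⟨M, fun θ => h7 _⟩, M', fun θ => ?_⟩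
    · refine hpolar _ _ (ellipseMap a b θ).1 (ellipseMap a b θ).2 ?_
      rw [← h4, ← hre, add_comm]
      push_cast
      rw [neg_neg]
    · have := h5 (-(θ + 2 * Real.pi))
      rw [show -(θ + 2 * Real.pi) + 2 * Real.pi = -θ by ring] at this
      exact this.symm
    · have := h6 (-(θ + 2 * Real.pi))
      rw [show -(θ + 2 * Real.pi) + 2 * Real.pi = -θ by ring] at this
      simp only [this]
      ring
    · have := h8 (-θ)
      rwa [show ψ (-θ) - -1 * θ = ψ (-θ) - -θ by ring]

/-- Every nonzero point is a positive multiple of a point of a given ellipse around the origin. -/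
theorem exists_eq_smul_ellipseMap {a b : ℝ × ℝ} (hab : a.1 * b.2 - a.2 * b.1 ≠ 0) {κ : ℝ}
    (hκ : κ = 1 ∨ κ = -1) :
    ∃ K > 0, ∀ p : ℝ × ℝ, p ≠ 0 → ∃ ρ > 0, ∃ φ ∈ Icc 0 (2 * Real.pi),
      p = ρ • ellipseMap a b (κ * φ) ∧ ρ ≤ K * ‖p‖ := by
  set D := a.1 * b.2 - a.2 * b.1 with hD
  have hD' : 0 < |D| := abs_pos.2 hab
  refine ⟨(|a.1| + |a.2| + |b.1| + |b.2| + 1) / |D|, by positivity, fun p hp => ?_⟩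
  -- Cramer's rule: the coordinates of `p` in the basis `a, b`, the second one reflected by `κ`. The
  -- modulus and argument of `z` are the required `ρ` and `φ`.
  let z : ℂ := ⟨(p.1 * b.2 - p.2 * b.1) / D, κ * ((p.2 * a.1 - p.1 * a.2) / D)⟩
  have hκ2 : κ * κ = 1 := by rcases hκ with rfl | rfl <;> norm_num
  have hp1 : p = z.re • a + (κ * z.im) • b := by
    have : κ * z.im = (p.2 * a.1 - p.1 * a.2) / D := by
      simp only [z]; rw [← mul_assoc, hκ2, one_mul]
    rw [this]
    ext
    · simp only [z, Prod.fst_add, Prod.smul_fst, smul_eq_mul]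
      field_simp
      rw [hD]; ring
    · simp only [z, Prod.snd_add, Prod.smul_snd, smul_eq_mul]
      field_simp
      rw [hD]; ring
  have hz : z ≠ 0 := by
    intro h
    apply hp
    rw [hp1, h]
    simp
  refine ⟨‖z‖, norm_pos_iff.2 hz, toIcoMod Real.two_pi_pos 0 z.arg, ?_, ?_, ?_⟩
  · have := toIcoMod_mem_Ico Real.two_pi_pos 0 z.arg
    rw [zero_add] at this
    exact Ico_subset_Icc_self this
  · set φ := toIcoMod Real.two_pi_pos 0 z.arg with hφ
    have hφ' : φ = z.arg - toIcoDiv Real.two_pi_pos 0 z.arg * (2 * Real.pi) := by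
      rw [hφ, toIcoMod, zsmul_eq_mul]
    have hc : Real.cos φ = Real.cos z.arg := by rw [hφ', Real.cos_sub_int_mul_two_pi]
    have hs : Real.sin φ = Real.sin z.arg := by rw [hφ', Real.sin_sub_int_mul_two_pi]
    have hc' : Real.cos (κ * φ) = Real.cos φ := by rcases hκ with rfl | rfl <;> simp
    have hs' : Real.sin (κ * φ) = κ * Real.sin φ := by rcases hκ with rfl | rfl <;> simp
    rw [ellipseMap, hc', hs', hc, hs, smul_add, smul_smul, smul_smul, Complex.norm_mul_cos_arg,
      mul_left_comm, Complex.norm_mul_sin_arg]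
    exact hp1
  · have h1 : |p.1| ≤ ‖p‖ := norm_fst_le p
    have h2 : |p.2| ≤ ‖p‖ := norm_snd_le p
    refine (Complex.norm_le_abs_re_add_abs_im z).trans ?_
    have hκa : |κ| = 1 := by rcases hκ with rfl | rfl <;> simp
    simp only [z, abs_div, abs_mul, hκa, one_mul]
    rw [← add_div, div_mul_eq_mul_div]
    refine div_le_div_of_nonneg_right ?_ hD'.le
    have h3 := abs_sub (p.1 * b.2) (p.2 * b.1)
    have h4 := abs_sub (p.2 * a.1) (p.1 * a.2)
    simp only [abs_mul] at h3 h4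
    nlinarith [norm_nonneg p, mul_le_mul_of_nonneg_right h1 (abs_nonneg b.2),
      mul_le_mul_of_nonneg_right h2 (abs_nonneg b.1),
      mul_le_mul_of_nonneg_right h2 (abs_nonneg a.1),
      mul_le_mul_of_nonneg_right h1 (abs_nonneg a.2)]

/-! ### Orbits of a field in polar form -/

/-- A field that is a rotation of speed `w` plus terms of higher order, in the polar coordinates
`r • ellipseMap a b θ`. -/
structure IsPolarField (F : ℝ × ℝ → ℝ × ℝ) (a b : ℝ × ℝ) (w : ℝ) (A C : ℝ → ℝ → ℝ) : Prop where
  det_ne_zero : a.1 * b.2 - a.2 * b.1 ≠ 0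
  speed_pos : 0 < w
  map_smul : ∀ r θ, F (r • ellipseMap a b θ) =
    (r ^ 2 * A r θ) • ellipseMap a b θ + (r * (w + r * C r θ)) • ellipseMap b (-a) θ
  continuous_angular : Continuous fun p : ℝ × ℝ => C p.1 p.2
  radial_periodic : ∀ r θ, A r (θ + 2 * Real.pi) = A r θ
  angular_periodic : ∀ r θ, C r (θ + 2 * Real.pi) = C r θ

/-- A solution of the radial equation, parametrized by the angle, together with a solution of the
angular equation gives an integral curve. The sign `κ` allows for reversal of time. -/
theorem IsPolarField.isIntegralCurveOn {F : ℝ × ℝ → ℝ × ℝ} {a b : ℝ × ℝ} {w : ℝ} {A C : ℝ → ℝ → ℝ}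
    (h : IsPolarField F a b w A C) {κ : ℝ} {f Θ : ℝ → ℝ} {I S : Set ℝ}
    (hΘ : ∀ t ∈ S, Θ t ∈ I ∧ HasDerivAt Θ (w + f (Θ t) * C (f (Θ t)) (κ * Θ t)) t)
    (hf : ∀ θ ∈ I, HasDerivWithinAt f
      (κ * (f θ ^ 2 * A (f θ) (κ * θ) / (w + f θ * C (f θ) (κ * θ)))) I θ)
    (h0 : ∀ θ ∈ I, w + f θ * C (f θ) (κ * θ) ≠ 0) :
    IsIntegralCurveOn (fun t => f (Θ t) • ellipseMap a b (κ * Θ t)) (fun _ p => κ • F p) S := by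
  intro t ht
  obtain ⟨hI, hd⟩ := hΘ t ht
  have h1 : HasDerivWithinAt (fun t => f (Θ t)) _ S t :=
    (hf _ hI).comp t hd.hasDerivWithinAt fun x hx => (hΘ x hx).1
  have h2 : HasDerivWithinAt (fun t => ellipseMap a b (κ * Θ t)) _ S t :=
    ((hasDerivAt_ellipseMap a b _).scomp t (hd.const_mul κ)).hasDerivWithinAt
  refine (h1.fun_smul h2).congr_deriv ?_
  have h3 := h0 _ hI
  dsimp only
  rw [h.map_smul, smul_add, smul_smul, smul_smul, smul_smul, add_comm]
  congr 2
  · field_simp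
  · exact mul_left_comm _ _ _

/-- A continuous family of positive solutions `g s` of the radial equation over one turn. -/
def IsRadialFamily (w : ℝ) (A C : ℝ → ℝ → ℝ) (κ δ : ℝ) (g : ℝ → ℝ → ℝ) : Prop :=
  ∀ s ∈ Ioo 0 δ, ∀ θ ∈ Icc 0 (2 * Real.pi),
    ContinuousAt (fun s => g s θ) s ∧ s / 2 ≤ g s θ ∧ g s θ ≤ 2 * s ∧
    w / 2 ≤ w + g s θ * C (g s θ) (κ * θ) ∧ w + g s θ * C (g s θ) (κ * θ) ≤ 2 * w ∧
    HasDerivWithinAt (g s) (κ * (g s θ ^ 2 * A (g s θ) (κ * θ) /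
      (w + g s θ * C (g s θ) (κ * θ)))) (Icc 0 (2 * Real.pi)) θ

theorem sub_floor_div_mul_mem_Icc {L x : ℝ} (hL : 0 < L) (hx : 0 ≤ x) :
    x - ⌊x / L⌋₊ * L ∈ Icc 0 L := by
  have h1 := (le_div_iff₀ hL).1 (Nat.floor_le (a := x / L) (by positivity))
  have h2 := (div_lt_iff₀ hL).1 (Nat.lt_floor_add_one (x / L))
  constructor <;> linarith

/-- If the solutions of a radial family can be concatenated turn by turn, then every point near the
origin lies on an orbit obtained in this way. -/
theorem IsPolarField.exists_orbit {F : ℝ × ℝ → ℝ × ℝ} {a b : ℝ × ℝ} {w : ℝ} {A C : ℝ → ℝ → ℝ}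
    (h : IsPolarField F a b w A C) {κ : ℝ} (hκ : κ = 1 ∨ κ = -1) {δ : ℝ} (hδ : 0 < δ)
    {g : ℝ → ℝ → ℝ} (hg : IsRadialFamily w A C κ δ g) {N : ℝ → ℝ}
    (hN : ∀ s ∈ Ioo 0 δ, N s ∈ Ioo 0 δ ∧ g s (2 * Real.pi) = g (N s) 0) :
    ∃ δ' > 0, ∀ p : ℝ × ℝ, p ≠ 0 → ‖p‖ < δ' → ∃ s ∈ Ioo 0 δ, ∃ φ ∈ Icc 0 (2 * Real.pi),
      ∃ f Θ : ℝ → ℝ, (∀ n : ℕ, ∀ θ ∈ Icc 0 (2 * Real.pi),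
        f (n * (2 * Real.pi) + θ) = g (N^[n] s) θ) ∧ ContinuousOn f (Ici 0) ∧
      (∀ θ ∈ Ici (0 : ℝ), 0 < f θ) ∧ Θ 0 = φ ∧ StrictMono Θ ∧ Continuous Θ ∧
      Function.Surjective Θ ∧ p = f φ • ellipseMap a b (κ * φ) ∧
      IsIntegralCurveOn (fun t => f (Θ t) • ellipseMap a b (κ * Θ t)) (fun _ p => κ • F p)
        (Ici 0) := by
  have hπ := Real.two_pi_pos
  obtain ⟨K, hK, hpol⟩ := exists_eq_smul_ellipseMap h.det_ne_zero hκ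
  refine ⟨δ / (4 * K), by positivity, fun p hp hpn => ?_⟩
  obtain ⟨ρ, hρ, φ, hφ, hpφ, hρK⟩ := hpol p hp
  have hρδ : ρ < δ / 4 := by
    rw [lt_div_iff₀ (by positivity)] at hpn
    nlinarith
  -- The solution through `p` is found by the intermediate value theorem in `s`: at angle `φ` the
  -- family is at most `ρ` for `s = ρ / 2` and at least `δ / 4 > ρ` for `s = δ / 2`.
  obtain ⟨s, hs, hsρ⟩ : ∃ s ∈ Ioo 0 δ, g s φ = ρ := by
    have hsub : Icc (ρ / 2) (δ / 2) ⊆ Ioo 0 δ := fun x hx =>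
      ⟨by linarith [hx.1], by linarith [hx.2]⟩
    have hle : ρ / 2 ≤ δ / 2 := by linarith
    have hcont : ContinuousOn (fun s => g s φ) (Icc (ρ / 2) (δ / 2)) := fun s hs =>
      ((hg s (hsub hs) φ hφ).1).continuousWithinAt
    have h1 := (hg _ (hsub (left_mem_Icc.2 hle)) φ hφ).2.2.1
    have h2 := (hg _ (hsub (right_mem_Icc.2 hle)) φ hφ).2.1
    obtain ⟨s, hs, hs'⟩ := intermediate_value_Icc hle hcont
      (show ρ ∈ Icc _ _ from ⟨by linarith, by linarith⟩)
    exact ⟨s, hsub hs, hs'⟩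
  have hNs (n : ℕ) : N^[n] s ∈ Ioo 0 δ := by
    induction n with
    | zero => exact hs
    | succ n ih =>
      rw [Function.iterate_succ_apply']
      exact (hN _ ih).1
  have hper {B : ℝ → ℝ → ℝ} (hB : ∀ r θ, B r (θ + 2 * Real.pi) = B r θ) (r θ : ℝ) :
      B r (κ * (θ + 2 * Real.pi)) = B r (κ * θ) := by
    rcases hκ with rfl | rfl
    · rw [one_mul, one_mul, hB]
    · rw [← hB r (-1 * (θ + 2 * Real.pi))]
      congr 1
      ring
  obtain ⟨f, hfg, hfd⟩ := exists_glued_solution hπ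
    (R := fun r θ => κ * (r ^ 2 * A r (κ * θ) / (w + r * C r (κ * θ))))
    (fun r θ => by simp only [hper h.radial_periodic, hper h.angular_periodic])
    (f := fun n => g (N^[n] s)) (fun n θ hθ => (hg _ (hNs n) θ hθ).2.2.2.2.2)
    (fun n => by rw [Function.iterate_succ_apply']; exact (hN _ (hNs n)).2)
  have hfc : ContinuousOn f (Ici 0) := fun θ hθ => (hfd θ hθ).continuousWithinAt
  have hpiece (x : ℝ) (hx : x ∈ Ici (0 : ℝ)) :
      f x = g (N^[⌊x / (2 * Real.pi)⌋₊] s) (x - ⌊x / (2 * Real.pi)⌋₊ * (2 * Real.pi)) := by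
    rw [← hfg _ _ (sub_floor_div_mul_mem_Icc hπ hx)]
    congr 1
    ring
  have hCn (n : ℕ) (r θ : ℝ) : C r (κ * (θ - n * (2 * Real.pi))) = C r (κ * θ) := by
    induction n with
    | zero => simp
    | succ k ih =>
      rw [← ih, ← hper h.angular_periodic]
      congr 2
      push_cast
      ring
  have hsp (x : ℝ) (hx : x ∈ Ici (0 : ℝ)) : w / 2 ≤ w + f x * C (f x) (κ * x) ∧
      w + f x * C (f x) (κ * x) ≤ 2 * w := by
    have h1 := hg _ (hNs ⌊x / (2 * Real.pi)⌋₊) _ (sub_floor_div_mul_mem_Icc hπ hx)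
    rw [← hpiece x hx, hCn] at h1
    exact ⟨h1.2.2.2.1, h1.2.2.2.2.1⟩
  -- The radius `f` is controlled on `[0, ∞)` only. Clamping the angle there gives a speed with
  -- global bounds and changes nothing for `t ≥ 0`, where `Θ t ≥ φ ≥ 0`.
  have hmax (x : ℝ) : max x 0 ∈ Ici (0 : ℝ) := mem_Ici.2 (le_max_right _ _)
  have hfm : Continuous fun x => f (max x 0) :=
    hfc.comp_continuous (continuous_id.max continuous_const) hmax
  have hG : Continuous fun x => w + f (max x 0) * C (f (max x 0)) (κ * max x 0) :=
    continuous_const.add (hfm.mul (h.continuous_angular.comp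
      (hfm.prodMk (continuous_const.mul (continuous_id.max continuous_const)))))
  obtain ⟨Θ, hΘ0, hΘd, hΘm, hΘs⟩ := exists_solution_of_speed_bounds hG (half_pos h.speed_pos)
    (fun x => (hsp _ (hmax x)).1) (fun x => (hsp _ (hmax x)).2) φ
  refine ⟨s, hs, φ, hφ, f, Θ, hfg, hfc, fun θ hθ => ?_, hΘ0, hΘm,
    continuous_iff_continuousAt.2 fun t => (hΘd t).continuousAt, hΘs, ?_, ?_⟩
  · rw [hpiece θ hθ]
    have h1 := hNs ⌊θ / (2 * Real.pi)⌋₊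
    have h2 := (hg _ h1 _ (sub_floor_div_mul_mem_Icc hπ hθ)).2.1
    linarith [h1.1]
  · have := hfg 0 φ hφ
    simp only [Nat.cast_zero, zero_mul, zero_add, Function.iterate_zero, id] at this
    rw [this, hsρ]
    exact hpφ
  · refine h.isIntegralCurveOn (I := Ici 0) (fun t (ht : 0 ≤ t) => ?_) hfd fun θ hθ =>
      ((half_pos h.speed_pos).trans_le (hsp θ hθ).1).ne'
    have h1 : 0 ≤ Θ t := by
      have := hΘm.monotone ht
      rw [hΘ0] at this
      exact hφ.1.trans this
    have h2 := hΘd t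
    rw [max_eq_left h1] at h2
    exact ⟨h1, h2⟩

/-! ### Criteria for a focus and a center -/

theorem IsPolarField.map_zero {F : ℝ × ℝ → ℝ × ℝ} {a b : ℝ × ℝ} {w : ℝ} {A C : ℝ → ℝ → ℝ}
    (h : IsPolarField F a b w A C) : F 0 = 0 := by
  have := h.map_smul 0 0
  simpa using this

/-- During turn `n` the radius is at most `2 * N^[n] s`, which tends to `0`, while the true polar
angle stays within a bounded distance of `±Θ`, which is unbounded. -/
theorem IsPolarField.isStableFocus {F : ℝ × ℝ → ℝ × ℝ} {a b : ℝ × ℝ} {w : ℝ} {A C : ℝ → ℝ → ℝ}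
    (h : IsPolarField F a b w A C) {κ : ℝ} (hκ : κ = 1 ∨ κ = -1) {δ : ℝ} (hδ : 0 < δ)
    {g : ℝ → ℝ → ℝ} (hg : IsRadialFamily w A C κ δ g) {N : ℝ → ℝ}
    (hN : ∀ s ∈ Ioo 0 δ, N s ∈ Ioo 0 δ ∧ g s (2 * Real.pi) = g (N s) 0)
    (hN0 : ∀ s ∈ Ioo 0 δ, Tendsto (fun n => N^[n] s) atTop (𝓝 0)) :
    IsStableFocus fun p => κ • F p := by
  have hπ := Real.two_pi_pos
  obtain ⟨m, ψ, ι, hι, hmc, hψc, hm0, hmψ, -, -, ⟨M, hM⟩, B, hB⟩ :=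
    exists_polar_lift_ellipseMap h.det_ne_zero
  obtain ⟨δ', hδ', horb⟩ := h.exists_orbit hκ hδ hg hN
  refine ⟨by simp [h.map_zero], δ', hδ', fun p hp hpn => ?_⟩
  obtain ⟨s, hs, φ, hφ, f, Θ, hfg, hfc, hf0, hΘ0, hΘm, hΘc, hΘs, hpf, hcurve⟩ := horb p hp hpn
  have hNs (n : ℕ) : N^[n] s ∈ Ioo 0 δ := by
    induction n with
    | zero => exact hs
    | succ n ih =>
      rw [Function.iterate_succ_apply']
      exact (hN _ ih).1
  have hΘn (t : ℝ) (ht : t ∈ Ici (0 : ℝ)) : Θ t ∈ Ici (0 : ℝ) := by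
    have := hΘm.monotone (mem_Ici.1 ht)
    rw [hΘ0] at this
    exact hφ.1.trans this
  have hΘt : Tendsto Θ atTop atTop := by
    refine hΘm.monotone.tendsto_atTop_atTop fun x => ?_
    obtain ⟨t, rfl⟩ := hΘs x
    exact ⟨t, le_rfl⟩
  refine ⟨_, fun t => f (Θ t) * m (κ * Θ t), fun t => ψ (κ * Θ t), ?_, hcurve, ⟨?_, ?_, ?_⟩, ?_, ?_⟩
  · simp only [hΘ0]
    exact hpf.symm
  · exact (hfc.comp hΘc.continuousOn hΘn).mul
      (hmc.comp (continuous_const.mul hΘc)).continuousOn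
  · exact (hψc.comp (continuous_const.mul hΘc)).continuousOn
  · intro t ht
    refine ⟨mul_pos (hf0 _ (hΘn t ht)) (hm0 _), ?_⟩
    simp only [hmψ]
    simp [mul_assoc]
  · have hft : Tendsto f atTop (𝓝 0) := by
      have h1 : Tendsto (fun x : ℝ => ⌊x / (2 * Real.pi)⌋₊) atTop atTop :=
        tendsto_nat_floor_atTop.comp (tendsto_id.atTop_div_const hπ)
      have h2 : Tendsto (fun x : ℝ => 2 * N^[⌊x / (2 * Real.pi)⌋₊] s) atTop (𝓝 0) := by
        simpa using ((hN0 s hs).comp h1).const_mul 2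
      refine tendsto_of_tendsto_of_tendsto_of_le_of_le' tendsto_const_nhds h2 ?_ ?_
      · filter_upwards [eventually_ge_atTop 0] with x hx using (hf0 x hx).le
      · filter_upwards [eventually_ge_atTop 0] with x hx
        have h3 := hfg ⌊x / (2 * Real.pi)⌋₊ _ (sub_floor_div_mul_mem_Icc hπ hx)
        rw [add_sub_cancel] at h3
        rw [h3]
        exact (hg _ (hNs _) _ (sub_floor_div_mul_mem_Icc hπ hx)).2.2.1
    have h4 : Tendsto (fun t => f (Θ t) * M) atTop (𝓝 0) := by
      simpa using (hft.comp hΘt).mul_const M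
    refine tendsto_of_tendsto_of_tendsto_of_le_of_le' tendsto_const_nhds h4 ?_ ?_
    · filter_upwards [eventually_ge_atTop 0] with t ht
      exact (mul_pos (hf0 _ (hΘn t ht)) (hm0 _)).le
    · filter_upwards [eventually_ge_atTop 0] with t ht
      exact mul_le_mul_of_nonneg_left (hM _) (hf0 _ (hΘn t ht)).le
  · refine tendsto_atTop_mono' _ ?_ (tendsto_atTop_add_const_right _ (-B) hΘt)
    filter_upwards [eventually_ge_atTop 0] with t ht
    have h5 := hB (κ * Θ t)
    have h6 : |ι * (κ * Θ t)| = Θ t := by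
      rw [abs_mul, abs_mul, abs_of_nonneg (mem_Ici.1 (hΘn t ht))]
      rcases hι with rfl | rfl <;> rcases hκ with rfl | rfl <;> simp
    have h7 := abs_sub_abs_le_abs_sub (ι * (κ * Θ t)) (ψ (κ * Θ t))
    rw [abs_sub_comm, h6] at h7
    linarith

/-- Concatenation with `N = id` repeats the same radial solution on every turn, so the orbit closes
when the angle has advanced by `2π` from its starting value `φ`. -/
theorem IsPolarField.isCenter {F : ℝ × ℝ → ℝ × ℝ} {a b : ℝ × ℝ} {w : ℝ} {A C : ℝ → ℝ → ℝ}
    (h : IsPolarField F a b w A C) {δ : ℝ} (hδ : 0 < δ) {g : ℝ → ℝ → ℝ}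
    (hg : IsRadialFamily w A C 1 δ g) (hN : ∀ s ∈ Ioo 0 δ, g s (2 * Real.pi) = g s 0) :
    IsCenter F := by
  have hπ := Real.two_pi_pos
  obtain ⟨m, ψ, ι, hι, hmc, hψc, hm0, hmψ, hmp, hψp, -, -⟩ :=
    exists_polar_lift_ellipseMap h.det_ne_zero
  obtain ⟨δ', hδ', horb⟩ := h.exists_orbit (Or.inl rfl) hδ hg (N := id) fun s hs => ⟨hs, hN s hs⟩
  refine ⟨h.map_zero, δ', hδ', fun p hp hpn => ?_⟩
  obtain ⟨s, hs, φ, hφ, f, Θ, hfg, hfc, hf0, hΘ0, hΘm, hΘc, hΘs, hpf, hcurve⟩ := horb p hp hpn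
  simp only [one_smul, one_mul, Function.iterate_id, id] at hcurve hfg hpf
  obtain ⟨T, hT⟩ := hΘs (φ + 2 * Real.pi)
  have hT0 : 0 < T := hΘm.lt_iff_lt.1 (by rw [hΘ0, hT]; linarith)
  have hΘn (t : ℝ) (ht : t ∈ Icc 0 T) : Θ t ∈ Ici (0 : ℝ) := by
    have := hΘm.monotone ht.1
    rw [hΘ0] at this
    exact hφ.1.trans this
  refine ⟨T, hT0, _, fun t => f (Θ t) * m (Θ t), fun t => ψ (Θ t), ?_,
    hcurve.mono Icc_subset_Ici_self, ⟨?_, ?_, ?_⟩, ?_, ?_⟩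
  · simp only [hΘ0]
    exact hpf.symm
  · exact (hfc.comp hΘc.continuousOn hΘn).mul (hmc.comp hΘc).continuousOn
  · exact (hψc.comp hΘc).continuousOn
  · intro t ht
    refine ⟨mul_pos (hf0 _ (hΘn t ht)) (hm0 _), ?_⟩
    simp only [hmψ]
    simp [mul_assoc]
  · have h1 := hfg 1 φ hφ
    have h0 := hfg 0 φ hφ
    simp only [Nat.cast_one, one_mul, Nat.cast_zero, zero_mul, zero_add] at h1 h0
    simp only [hT, hΘ0, hmp]
    rw [add_comm φ, h1, h0]
  · simp only [hT, hΘ0, hψp, add_sub_cancel_left, abs_mul, abs_of_pos hπ]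
    rcases hι with rfl | rfl <;> simp

/-- A strictly decreasing self-map of `(0, δ)` whose graph is contained in that of a continuous
relation without fixed points has all orbits tending to `0`. -/
theorem tendsto_iterate_zero {δ : ℝ} {N p q : ℝ → ℝ} (hN : ∀ s ∈ Ioo 0 δ, 0 < N s ∧ N s < s)
    (hp : ContinuousOn p (Ioo 0 δ)) (hq : ContinuousOn q (Ioo 0 δ))
    (hpq : ∀ s ∈ Ioo 0 δ, p s = q (N s)) (hne : ∀ s ∈ Ioo 0 δ, p s ≠ q s) {s : ℝ}
    (hs : s ∈ Ioo 0 δ) : Tendsto (fun n => N^[n] s) atTop (𝓝 0) := by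
  have hmem (n : ℕ) : N^[n] s ∈ Ioo 0 δ := by
    induction n with
    | zero => exact hs
    | succ n ih =>
      rw [Function.iterate_succ_apply']
      exact ⟨(hN _ ih).1, (hN _ ih).2.trans ih.2⟩
  have hanti : Antitone fun n => N^[n] s := antitone_nat_of_succ_le fun n => by
    rw [Function.iterate_succ_apply']
    exact (hN _ (hmem n)).2.le
  have hlim := tendsto_atTop_ciInf hanti ⟨0, by rintro _ ⟨n, rfl⟩; exact (hmem n).1.le⟩
  set l := ⨅ n, N^[n] s
  have hl0 : 0 ≤ l := ge_of_tendsto' hlim fun n => (hmem n).1.le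
  rcases hl0.eq_or_lt with h | h
  · rwa [h]
  -- A positive limit `l` would satisfy `p l = q l`. The relation `p s = q (N s)` stands in for
  -- continuity of `N`, which is not available when `N` is a chosen preimage.
  · exfalso
    have hlδ : l ∈ Ioo 0 δ :=
      ⟨h, (le_of_tendsto' hlim fun n => hanti (Nat.zero_le n)).trans_lt hs.2⟩
    have h1 := (hp.continuousAt (isOpen_Ioo.mem_nhds hlδ)).tendsto.comp hlim
    have h2 := (hq.continuousAt (isOpen_Ioo.mem_nhds hlδ)).tendsto.comp
      (hlim.comp (tendsto_add_atTop_nat 1))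
    refine hne l hlδ (tendsto_nhds_unique h1 (h2.congr fun n => ?_))
    simp only [Function.comp_apply, Function.iterate_succ_apply']
    exact (hpq _ (hmem n)).symm

/-- This makes the return after a full turn the first one. Lying on the section forces `sin θ = 0`,
hence `θ = π` inside the open turn, which is the opposite half-line. The number `s` only records
that `r` and `c` have the same sign. -/
theorem smul_ellipseMap_ne_smul {a b : ℝ × ℝ} (hab : a.1 * b.2 - a.2 * b.1 ≠ 0) {r c s θ : ℝ}
    (hθ : θ ∈ Ioo 0 (2 * Real.pi)) (hr : 0 < s * r) (hc : 0 < s * c) :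
    r • ellipseMap a b θ ≠ c • a := by
  intro h
  have h1 := congrArg Prod.fst h
  have h2 := congrArg Prod.snd h
  simp only [ellipseMap, Prod.smul_fst, Prod.fst_add, Prod.smul_snd, Prod.snd_add,
    smul_eq_mul] at h1 h2
  have hr0 : r ≠ 0 := right_ne_zero_of_mul hr.ne'
  have hsin : Real.sin θ = 0 := by
    have h3 : r * Real.sin θ * (a.1 * b.2 - a.2 * b.1) = 0 := by
      linear_combination a.1 * h2 - a.2 * h1
    simpa [hab, hr0] using h3
  have hcos : r * Real.cos θ = c := by
    have h3 : (r * Real.cos θ - c) * (a.1 * b.2 - a.2 * b.1) = 0 := by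
      linear_combination b.2 * h1 - b.1 * h2
    simpa [hab, sub_eq_zero] using h3
  have hπ : Real.cos θ = -1 := by
    obtain ⟨n, hn⟩ := Real.sin_eq_zero_iff.1 hsin
    have h4 : (0 : ℝ) < n := by
      have := hθ.1
      rw [← hn] at this
      exact pos_of_mul_pos_left this Real.pi_pos.le
    have h5 : (n : ℝ) < 2 := by
      have := hθ.2
      rw [← hn] at this
      exact lt_of_mul_lt_mul_right this Real.pi_pos.le
    have h6 : n = 1 := by
      have h4' : 0 < n := by exact_mod_cast h4
      have h5' : n < 2 := by exact_mod_cast h5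
      omega
    rw [← hn, h6]
    simp
  rw [hπ] at hcos
  rw [← hcos] at hc
  linarith

/-! ### The return map and the dichotomy -/

/-- Center-focus dichotomy and first return map for a polar field with polynomial terms. -/
theorem IsPolarField.exists_displacement {F : ℝ × ℝ → ℝ × ℝ} {a b : ℝ × ℝ} {w : ℝ}
    {ι : Type*} [Fintype ι] {d : ι → ℕ} {α β : ι → ℝ → ℝ}
    (h : IsPolarField F a b w (angularSum d α) (angularSum d β))
    (hα : ∀ i, Continuous (α i)) (hβ : ∀ i, Continuous (β i)) :
    ∃ W : ℝ → ℝ, AnalyticAt ℝ W 0 ∧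
      HasDerivAt W ((∫ θ in (0 : ℝ)..2 * Real.pi, ((∑ i with d i = 1, α i θ) / w -
        angularSum d α 0 θ * angularSum d β 0 θ / w ^ 2)) +
        (∫ θ in (0 : ℝ)..2 * Real.pi, angularSum d α 0 θ / w) ^ 2) 0 ∧
      ((∀ᶠ s in 𝓝 (0 : ℝ), W s = 0) → IsCenter F) ∧
      ((∀ᶠ s in 𝓝[≠] (0 : ℝ), W s ≠ 0) → IsFocus F) ∧
      IsPoincareMap F a fun s => s + s ^ 2 * W s := by
  have hπ := Real.two_pi_pos
  have hw := h.speed_pos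
  obtain ⟨u, W, hWa, hW', hev⟩ := exists_radial_solutions d hα hβ hw hπ
  obtain ⟨δ, hδ, hall⟩ := Metric.eventually_nhds_iff.1 (hev.and hWa.eventually_analyticAt)
  simp only [Real.dist_eq, sub_zero] at hall
  set r : ℝ → ℝ → ℝ := fun s θ => s * u s θ with hr
  have hr0 (s : ℝ) (hs : |s| < δ) : r s 0 = s := by simp [hr, (hall hs).1.1]
  have hrL (s : ℝ) (hs : |s| < δ) : r s (2 * Real.pi) = s + s ^ 2 * W s := by
    simp only [hr, (hall hs).1.2.1]
    ring
  have hrd (s : ℝ) (hs : |s| < δ) (θ : ℝ) (hθ : θ ∈ Icc 0 (2 * Real.pi)) :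
      HasDerivWithinAt (r s) (r s θ ^ 2 * angularSum d α (r s θ) θ /
        (w + r s θ * angularSum d β (r s θ) θ)) (Icc 0 (2 * Real.pi)) θ := by
    refine (((hall hs).1.2.2 θ hθ).2.2.2.2.2.const_mul s).congr_deriv ?_
    simp only [hr]
    ring
  have hfam {δ' : ℝ} (hδ' : δ' ≤ δ) :
      IsRadialFamily w (angularSum d α) (angularSum d β) 1 δ' r := by
    intro s hs θ hθ
    have hs' : |s| < δ := by
      rw [abs_of_pos hs.1]
      exact hs.2.trans_le hδ'
    obtain ⟨h1, h2, h3, h4, h5, -⟩ := (hall hs').1.2.2 θ hθ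
    rw [one_mul, one_mul]
    refine ⟨continuousAt_id.mul h1, ?_, ?_, h4, h5, hrd s hs' θ hθ⟩
    · simp only [hr]; nlinarith [hs.1]
    · simp only [hr]; nlinarith [hs.1]
  have habs {δ' s : ℝ} (hδ' : δ' ≤ δ) (hs : s ∈ Ioo 0 δ') : |s| < δ := by
    rw [abs_of_pos hs.1]
    exact hs.2.trans_le hδ'
  refine ⟨W, hWa, hW', fun hW0 => ?_, fun hW0 => ?_, ?_⟩
  · obtain ⟨δ₁, hδ₁, hz⟩ := Metric.eventually_nhds_iff.1 hW0
    simp only [Real.dist_eq, sub_zero] at hz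
    refine h.isCenter (lt_min hδ hδ₁) (hfam (min_le_left _ _)) fun s hs => ?_
    have hsδ := habs (min_le_left _ _) hs
    rw [hr0 s hsδ, hrL s hsδ, hz]
    · ring
    · rw [abs_of_pos hs.1]
      exact hs.2.trans_le (min_le_right _ _)
  · obtain ⟨δ₁, hδ₁, hz⟩ := Metric.eventually_nhds_iff.1 (eventually_nhdsWithin_iff.1 hW0)
    simp only [Real.dist_eq, sub_zero, mem_compl_iff, mem_singleton_iff] at hz
    set ε := min δ δ₁ with hε
    have hε0 : 0 < ε := lt_min hδ hδ₁
    have hεδ : ε ≤ δ := min_le_left _ _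
    have hWne : ∀ s ∈ Ioo 0 ε, W s ≠ 0 := fun s hs => hz (by
      rw [abs_of_pos hs.1]
      exact hs.2.trans_le (min_le_right _ _)) hs.1.ne'
    have hWc : ContinuousOn W (Ioo 0 ε) := fun s hs =>
      (hall (habs hεδ hs)).2.continuousAt.continuousWithinAt
    set P : ℝ → ℝ := fun s => s + s ^ 2 * W s with hP
    have hPc : ContinuousOn P (Ioo 0 ε) := continuousOn_id.add ((continuousOn_id.pow 2).mul hWc)
    have hPr : ∀ s ∈ Ioo 0 ε, r s (2 * Real.pi) = P s := fun s hs => hrL s (habs hεδ hs)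
    have hPpos : ∀ s ∈ Ioo 0 ε, s / 2 ≤ P s := fun s hs => by
      rw [← hPr s hs]
      exact (hfam hεδ s hs _ (right_mem_Icc.2 hπ.le)).2.1
    have hPne : ∀ s ∈ Ioo 0 ε, P s ≠ s := fun s hs hPs => by
      have h1 : s ^ 2 * W s = 0 := by
        simp only [hP] at hPs
        linarith
      exact (mul_ne_zero (pow_ne_zero 2 hs.1.ne') (hWne s hs)) h1
    -- `W` is continuous without zeros on an interval. Its sign decides whether `P` contracts
    -- towards the origin or moves away from it.
    have hsign : (∀ s ∈ Ioo 0 ε, W s < 0) ∨ ∀ s ∈ Ioo 0 ε, 0 < W s := by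
      by_contra hcon
      push Not at hcon
      obtain ⟨⟨s, hs, hs0⟩, t, ht, ht0⟩ := hcon
      obtain ⟨x, hx, hx0⟩ := isPreconnected_Ioo.intermediate_value ht hs hWc ⟨ht0, hs0⟩
      exact hWne x hx hx0
    rcases hsign with hneg | hpos
    · left
      have hN : ∀ s ∈ Ioo 0 ε, 0 < P s ∧ P s < s := fun s hs => by
        refine ⟨by linarith [hPpos s hs, hs.1], ?_⟩
        have := mul_neg_of_pos_of_neg (pow_pos hs.1 2) (hneg s hs)
        simp only [hP]
        linarith
      have := h.isStableFocus (Or.inl rfl) hε0 (hfam hεδ) (N := P)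
        (fun s hs => by
          have h1 : P s ∈ Ioo 0 ε := ⟨(hN s hs).1, (hN s hs).2.trans hs.2⟩
          exact ⟨h1, by rw [hPr s hs, hr0 _ (habs hεδ h1)]⟩)
        (fun s hs => tendsto_iterate_zero hN hPc continuousOn_id (fun s _ => rfl)
          (fun s hs => hPne s hs) hs)
      simpa using this
    · right
      have hPgt : ∀ s ∈ Ioo 0 ε, s < P s := fun s hs => by
        have := mul_pos (pow_pos hs.1 2) (hpos s hs)
        simp only [hP]
        linarith
      -- When `P` expands, one turn backwards is a preimage under `P`. It exists because `P (s / 3)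
      -- ≤ 2 s / 3` and `s < P s`.
      have hpre : ∀ s, ∃ t, s ∈ Ioo 0 ε → t ∈ Ioo 0 s ∧ P t = s := fun s => by
        by_cases hs : s ∈ Ioo 0 ε
        · have h3 : s / 3 ∈ Ioo 0 ε := ⟨by linarith [hs.1], by linarith [hs.1, hs.2]⟩
          have hsub : Icc (s / 3) s ⊆ Ioo 0 ε := fun x hx =>
            ⟨by linarith [hx.1, hs.1], hx.2.trans_lt hs.2⟩
          have h4 : P (s / 3) ≤ s := by
            rw [← hPr _ h3]
            have := (hfam hεδ _ h3 _ (right_mem_Icc.2 hπ.le)).2.2.1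
            linarith [hs.1]
          obtain ⟨t, ht, hPt⟩ := intermediate_value_Icc (by linarith [hs.1]) (hPc.mono hsub)
            ⟨h4, (hPgt s hs).le⟩
          refine ⟨t, fun _ => ⟨⟨by linarith [ht.1, hs.1], ?_⟩, hPt⟩⟩
          have := hPgt t (hsub ht)
          rwa [hPt] at this
        · exact ⟨0, fun h => absurd h hs⟩
      choose Q hQ using hpre
      have hQm : ∀ s ∈ Ioo 0 ε, Q s ∈ Ioo 0 ε := fun s hs =>
        ⟨(hQ s hs).1.1, (hQ s hs).1.2.trans hs.2⟩
      have hper {ρ θ : ℝ} {B : ℝ → ℝ → ℝ} (hB : ∀ r θ, B r (θ + 2 * Real.pi) = B r θ) :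
          B ρ (-1 * θ) = B ρ (2 * Real.pi - θ) := by
        rw [← hB]
        congr 1
        ring
      -- The same solutions traversed backwards: these start at radius `P s` and end at `s`, so the
      -- successor of `s` is `Q s`, where `P (Q s) = s`.
      have hrev : IsRadialFamily w (angularSum d α) (angularSum d β) (-1) ε
          fun s θ => r s (2 * Real.pi - θ) := by
        intro s hs θ hθ
        have hθ' : 2 * Real.pi - θ ∈ Icc 0 (2 * Real.pi) :=
          ⟨by linarith [hθ.2], by linarith [hθ.1]⟩
        obtain ⟨h1, h2, h3, h4, h5, h6⟩ := hfam hεδ s hs _ hθ'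
        simp only [one_mul] at h4 h5 h6
        rw [hper h.angular_periodic, hper h.radial_periodic]
        refine ⟨h1, h2, h3, h4, h5, ?_⟩
        have h7 : HasDerivWithinAt (fun θ => 2 * Real.pi - θ) (-1) (Icc 0 (2 * Real.pi)) θ :=
          (hasDerivWithinAt_id θ _).const_sub _
        refine (h6.comp θ h7 fun x (hx : x ∈ Icc 0 (2 * Real.pi)) =>
          (⟨by linarith [hx.2], by linarith [hx.1]⟩ : _ ∧ _)).congr_deriv ?_
        ring
      have := h.isStableFocus (Or.inr rfl) hε0 hrev (N := Q)
        (fun s hs => ⟨hQm s hs, by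
          simp only [sub_self, sub_zero]
          rw [hr0 _ (habs hεδ hs), hPr _ (hQm s hs), (hQ s hs).2]⟩)
        (fun s hs => tendsto_iterate_zero (fun s hs => (hQ s hs).1) continuousOn_id hPc
          (fun s hs => (hQ s hs).2.symm) (fun s hs => (hPne s hs).symm) hs)
      simpa using this
  · refine ⟨by simp, δ, hδ, fun s hs0 hs => ?_⟩
    -- Here `s` may be negative and a single turn suffices. Clamping the angle to `[0, 2π]` again
    -- gives a speed defined and bounded on the whole line.
    let c : ℝ → ℝ := fun θ => max 0 (min θ (2 * Real.pi))
    have hcm (θ : ℝ) : c θ ∈ Icc 0 (2 * Real.pi) :=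
      ⟨le_max_left _ _, max_le hπ.le (min_le_right _ _)⟩
    have hcc : Continuous c := by fun_prop
    have hce (θ : ℝ) (hθ : θ ∈ Icc 0 (2 * Real.pi)) : c θ = θ := by
      simp only [c]
      rw [min_eq_left hθ.2, max_eq_right hθ.1]
    have hrc : Continuous fun θ => r s (c θ) :=
      ContinuousOn.comp_continuous (f := c) (g := r s) (s := Icc 0 (2 * Real.pi))
        (fun θ hθ => (hrd s hs θ hθ).continuousWithinAt) hcc hcm
    have hG : Continuous fun θ => w + r s (c θ) * angularSum d β (r s (c θ)) (c θ) :=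
      continuous_const.add (hrc.mul (h.continuous_angular.comp (hrc.prodMk hcc)))
    obtain ⟨Θ, hΘ0, hΘd, hΘm, hΘs⟩ := exists_solution_of_speed_bounds hG (half_pos hw)
      (fun θ => ((hall hs).1.2.2 _ (hcm θ)).2.2.2.1)
      (fun θ => ((hall hs).1.2.2 _ (hcm θ)).2.2.2.2.1) 0
    obtain ⟨T, hT⟩ := hΘs (2 * Real.pi)
    have hT0 : 0 < T := hΘm.lt_iff_lt.1 (by rw [hΘ0, hT]; exact hπ)
    have hspos (θ : ℝ) (hθ : θ ∈ Icc 0 (2 * Real.pi)) : 0 < s * r s θ := by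
      have h1 : 0 < u s θ := by linarith [((hall hs).1.2.2 θ hθ).2.1]
      have h2 : 0 < s ^ 2 := by positivity
      calc 0 < s ^ 2 * u s θ := mul_pos h2 h1
        _ = s * r s θ := by simp only [hr]; ring
    refine ⟨T, hT0, fun t => r s (Θ t) • ellipseMap a b (Θ t), ?_, ?_, ?_, ?_, fun t ht x hx => ?_⟩
    · have := h.isIntegralCurveOn (κ := 1) (f := r s) (Θ := Θ) (I := Icc 0 (2 * Real.pi))
        (S := Icc 0 T) (fun t ht => ?_) (fun θ hθ => ?_) fun θ hθ => ?_
      · simpa using this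
      · have h1 : Θ t ∈ Icc 0 (2 * Real.pi) := by
          have h2 := hΘm.monotone ht.1
          have h3 := hΘm.monotone ht.2
          rw [hΘ0] at h2
          rw [hT] at h3
          exact ⟨h2, h3⟩
        have h2 := hΘd t
        rw [hce _ h1] at h2
        rw [one_mul]
        exact ⟨h1, h2⟩
      · rw [one_mul, one_mul]
        exact hrd s hs θ hθ
      · rw [one_mul]
        exact ((half_pos hw).trans_le ((hall hs).1.2.2 θ hθ).2.2.2.1).ne'
    · simp [hΘ0, hr0 s hs, ellipseMap]
    · simp [hT, hrL s hs, ellipseMap]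
    · dsimp only
      rw [← hrL s hs]
      exact hspos _ (right_mem_Icc.2 hπ.le)
    · have h1 : Θ t ∈ Ioo 0 (2 * Real.pi) := by
        have h2 := hΘm ht.1
        have h3 := hΘm ht.2
        rw [hΘ0] at h2
        rw [hT] at h3
        exact ⟨h2, h3⟩
      exact smul_ellipseMap_ne_smul h.det_ne_zero h1 (hspos _ (Ioo_subset_Icc_self h1)) hx

/-- In the Leibniz formula only the term with two derivatives on `s²` survives at `0`, with
coefficient `3 · 2`. -/
theorem iteratedDeriv_three_sq_mul {W : ℝ → ℝ} {W' : ℝ} (hW : AnalyticAt ℝ W 0)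
    (hW' : HasDerivAt W W' 0) : iteratedDeriv 3 (fun s => s ^ 2 * W s) 0 = 6 * W' := by
  have h := iteratedDeriv_mul (n := 3) (f := fun s : ℝ => s ^ 2) (g := W) (x := 0)
    (by fun_prop) hW.contDiffAt
  have h' : iteratedDeriv 3 (fun s => s ^ 2 * W s) 0 = _ := h
  rw [h']
  simp [Finset.sum_range_succ, hW'.deriv, Nat.choose, iteratedDeriv_succ]
  norm_num

/-! ### Homogeneous parts of the boundary polynomial -/

theorem SimpleGraph.vertexBoundary_empty {V : Type*} [Fintype V] [DecidableEq V]
    (G : SimpleGraph V) [DecidableRel G.Adj] : G.vertexBoundary ∅ = ∅ := by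
  simp [SimpleGraph.vertexBoundary]

/-- Only singletons need an argument, and a neighbour of the vertex lies in the boundary. This is
where the absence of isolated vertices enters. -/
theorem SimpleGraph.two_le_card_vertexBoundary_add_card {V : Type*} [Fintype V] [DecidableEq V]
    (G : SimpleGraph V) [DecidableRel G.Adj] (hG : ∀ v, ∃ w, G.Adj v w) {S : Finset V}
    (hS : S ≠ ∅) : 2 ≤ (G.vertexBoundary S).card + S.card := by
  have h0 : 0 < S.card := Finset.card_pos.2 (Finset.nonempty_iff_ne_empty.2 hS)
  rcases Nat.lt_or_ge 1 S.card with h1 | h1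
  · omega
  · obtain ⟨v, rfl⟩ := Finset.card_eq_one.1 (by omega : S.card = 1)
    obtain ⟨x, hx⟩ := hG v
    have : x ∈ G.vertexBoundary {v} := by
      simp [SimpleGraph.vertexBoundary, hx, hx.ne']
    have := Finset.card_pos.2 ⟨x, this⟩
    rw [Finset.card_singleton]
    omega

/-- The degree of the term of a vertex set in the boundary polynomial, less `2`. -/
def SimpleGraph.boundaryDegree {V : Type*} [Fintype V] [DecidableEq V] (G : SimpleGraph V)
    [DecidableRel G.Adj] (S : Finset V) : ℕ := (G.vertexBoundary S).card + S.card - 2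

/-- The nonconstant term of a vertex set in the boundary polynomial. -/
def SimpleGraph.boundaryTerm {V : Type*} [Fintype V] [DecidableEq V] (G : SimpleGraph V)
    [DecidableRel G.Adj] (S : Finset V) (x y : ℝ) : ℝ :=
  if S = ∅ then 0 else x ^ (G.vertexBoundary S).card * y ^ S.card

/-- The empty set supplies the constant `1`. Its truncated `boundaryDegree` is `0`, which does no
harm because its `boundaryTerm` is `0`. -/
theorem SimpleGraph.boundaryPolynomial_mul {V : Type*} [Fintype V] [DecidableEq V]
    (G : SimpleGraph V) [DecidableRel G.Adj] (hG : ∀ v, ∃ w, G.Adj v w) (r x y : ℝ) :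
    G.boundaryPolynomial (r * x) (r * y) =
      1 + r ^ 2 * ∑ S, r ^ G.boundaryDegree S * G.boundaryTerm S x y := by
  have h1 : (1 : ℝ) = ∑ S : Finset V, if S = ∅ then 1 else 0 := by simp
  rw [SimpleGraph.boundaryPolynomial, h1, Finset.mul_sum, ← Finset.sum_add_distrib]
  refine Finset.sum_congr rfl fun S _ => ?_
  by_cases hS : S = ∅
  · subst hS
    simp [SimpleGraph.boundaryTerm, SimpleGraph.vertexBoundary_empty]
  · have h2 := G.two_le_card_vertexBoundary_add_card hG hS
    have h3 : (G.vertexBoundary S).card + S.card = 2 + G.boundaryDegree S := by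
      rw [SimpleGraph.boundaryDegree]
      omega
    simp only [SimpleGraph.boundaryTerm, if_neg hS]
    rw [zero_add, ← mul_assoc, ← pow_add, ← h3, pow_add, mul_pow, mul_pow]
    ring

/-- Sorting the sets by cardinality turns the homogeneous part of degree `k + 2` into boundary
coefficients. The values `k = 0` and `k = 1` give the quadratic and cubic parts, the only ones that
affect `W'(0)`. -/
theorem SimpleGraph.sum_boundaryTerm {V : Type*} [Fintype V] [DecidableEq V]
    (G : SimpleGraph V) [DecidableRel G.Adj] (hG : ∀ v, ∃ w, G.Adj v w) (k : ℕ) (x y : ℝ) :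
    ∑ S with G.boundaryDegree S = k, G.boundaryTerm S x y =
      ∑ j ∈ Finset.Icc 1 (k + 2), G.boundaryCoeff (k + 2 - j) j * (x ^ (k + 2 - j) * y ^ j) := by
  have h1 : ∑ S with G.boundaryDegree S = k, G.boundaryTerm S x y =
      ∑ S with S ≠ ∅ ∧ (G.vertexBoundary S).card + S.card = k + 2,
        x ^ (G.vertexBoundary S).card * y ^ S.card := by
    rw [Finset.sum_filter, Finset.sum_filter]
    refine Finset.sum_congr rfl fun S _ => ?_
    by_cases hS : S = ∅
    · simp [hS, SimpleGraph.boundaryTerm]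
    · have h2 := G.two_le_card_vertexBoundary_add_card hG hS
      have h3 : G.boundaryDegree S = k ↔ (G.vertexBoundary S).card + S.card = k + 2 := by
        rw [SimpleGraph.boundaryDegree]
        omega
      simp [hS, h3, SimpleGraph.boundaryTerm]
  rw [h1, ← Finset.sum_fiberwise_of_maps_to (g := Finset.card) (t := Finset.Icc 1 (k + 2))]
  · refine Finset.sum_congr rfl fun j hj => ?_
    rw [Finset.mem_Icc] at hj
    have h4 : (Finset.univ.filter fun S : Finset V =>
        S ≠ ∅ ∧ (G.vertexBoundary S).card + S.card = k + 2).filter (fun S => S.card = j) =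
        Finset.univ.filter fun S : Finset V =>
          (G.vertexBoundary S).card = k + 2 - j ∧ S.card = j := by
      ext S
      simp only [Finset.mem_filter, Finset.mem_univ, true_and]
      constructor
      · rintro ⟨⟨-, h⟩, rfl⟩
        exact ⟨by omega, rfl⟩
      · rintro ⟨h, rfl⟩
        exact ⟨⟨fun h0 => by simp [h0] at hj, by omega⟩, rfl⟩
    rw [h4, SimpleGraph.boundaryCoeff, ← nsmul_eq_mul, ← Finset.sum_const]
    refine Finset.sum_congr rfl fun S hS => ?_
    rw [Finset.mem_filter] at hS
    rw [hS.2.1, hS.2.2]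
  · intro S hS
    rw [Finset.mem_filter] at hS
    have := Finset.card_pos.2 (Finset.nonempty_iff_ne_empty.2 hS.2.1)
    rw [Finset.mem_Icc]
    omega

/-! ### The linear part at the origin -/

theorem SimpleGraph.hasFDerivAt_boundaryPolynomial {V : Type*} [Fintype V] [DecidableEq V]
    (G : SimpleGraph V) [DecidableRel G.Adj] (hG : ∀ v, ∃ w, G.Adj v w) :
    HasFDerivAt (fun p : ℝ × ℝ => G.boundaryPolynomial p.1 p.2) (0 : ℝ × ℝ →L[ℝ] ℝ) 0 := by
  have h : ∀ S ∈ (Finset.univ : Finset (Finset V)), HasFDerivAt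
      (fun p : ℝ × ℝ => p.1 ^ (G.vertexBoundary S).card * p.2 ^ S.card) (0 : ℝ × ℝ →L[ℝ] ℝ) 0 := by
    intro S _
    have h1 : HasFDerivAt (fun p : ℝ × ℝ => p.1 ^ (G.vertexBoundary S).card) _ 0 :=
      (hasFDerivAt_fst (𝕜 := ℝ) (E := ℝ) (F := ℝ)).pow _
    have h2 : HasFDerivAt (fun p : ℝ × ℝ => p.2 ^ S.card) _ 0 :=
      (hasFDerivAt_snd (𝕜 := ℝ) (E := ℝ) (F := ℝ)).pow _
    refine (h1.fun_mul h2).congr_fderiv ?_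
    by_cases hS : S = ∅
    · subst hS
      simp [SimpleGraph.vertexBoundary_empty]
    · have h3 := G.two_le_card_vertexBoundary_add_card hG hS
      obtain ⟨j, hj⟩ : ∃ j, S.card = j + 1 :=
        Nat.exists_eq_succ_of_ne_zero (Finset.card_ne_zero.2 (Finset.nonempty_iff_ne_empty.2 hS))
      rw [hj] at h3 ⊢
      rcases Nat.eq_zero_or_pos (G.vertexBoundary S).card with h0 | h0
      · have : j ≠ 0 := by omega
        ext <;> simp [h0, this]
      · have : (G.vertexBoundary S).card ≠ 0 := h0.ne'
        ext <;> simp [this]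
  have h' := HasFDerivAt.fun_sum h
  simpa [SimpleGraph.boundaryPolynomial] using h'

theorem jacobianMatrix_boundaryField {V₁ V₂ : Type*} [Fintype V₁] [DecidableEq V₁] [Fintype V₂]
    [DecidableEq V₂] (G₁ : SimpleGraph V₁) [DecidableRel G₁.Adj] (G₂ : SimpleGraph V₂)
    [DecidableRel G₂.Adj] (hG₁ : ∀ v, ∃ w, G₁.Adj v w) (hG₂ : ∀ v, ∃ w, G₂.Adj v w)
    (a₁ a₂ a₃ a₄ : ℝ) :
    jacobianMatrix (boundaryField G₁ G₂ a₁ a₂ a₃ a₄) 0 = !![a₁, a₂; a₃, a₄] := by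
  have hlin (b₁ b₂ : ℝ) : HasFDerivAt (fun p : ℝ × ℝ => b₁ * p.1 + b₂ * p.2)
      (b₁ • ContinuousLinearMap.fst ℝ ℝ ℝ + b₂ • ContinuousLinearMap.snd ℝ ℝ ℝ) 0 :=
    (hasFDerivAt_fst.const_mul b₁).add (hasFDerivAt_snd.const_mul b₂)
  have h : HasFDerivAt (boundaryField G₁ G₂ a₁ a₂ a₃ a₄) _ 0 :=
    (((hlin a₁ a₂).fun_add (G₁.hasFDerivAt_boundaryPolynomial hG₁)).sub_const 1).prodMk
      (((hlin a₃ a₄).fun_add (G₂.hasFDerivAt_boundaryPolynomial hG₂)).sub_const 1)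
  rw [jacobianMatrix, h.fderiv]
  ext i j
  fin_cases i <;> fin_cases j <;> simp [LinearMap.toMatrix_apply]

theorem roots_charpoly_of_trace_zero {a₁ a₂ a₃ a₄ : ℝ} (htrace : a₁ + a₄ = 0)
    (hdet : 0 < a₁ * a₄ - a₂ * a₃) :
    ((!![a₁, a₂; a₃, a₄] : Matrix (Fin 2) (Fin 2) ℝ).map Complex.ofReal).charpoly.roots =
      {Complex.I * (√(a₁ * a₄ - a₂ * a₃) : ℝ), -(Complex.I * (√(a₁ * a₄ - a₂ * a₃) : ℝ))} := by
  set w := √(a₁ * a₄ - a₂ * a₃) with hw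
  have hw2 : w ^ 2 = a₁ * a₄ - a₂ * a₃ := Real.sq_sqrt hdet.le
  have htr : ((a₁ : ℂ) + a₄) = 0 := by exact_mod_cast htrace
  have hde : (a₁ : ℂ) * a₄ - a₂ * a₃ = (w : ℂ) ^ 2 := by exact_mod_cast hw2.symm
  have h : ((!![a₁, a₂; a₃, a₄] : Matrix (Fin 2) (Fin 2) ℝ).map Complex.ofReal).charpoly =
      (Polynomial.X - Polynomial.C (Complex.I * w)) *
        (Polynomial.X - Polynomial.C (-(Complex.I * w))) := by
    rw [Matrix.charpoly_fin_two, Matrix.trace_fin_two, Matrix.det_fin_two]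
    simp only [Matrix.map_apply, Matrix.of_apply, Matrix.cons_val', Matrix.cons_val_zero,
      Matrix.cons_val_one, Matrix.cons_val_fin_one]
    rw [htr, hde]
    have hI : (Polynomial.C Complex.I : Polynomial ℂ) ^ 2 = -1 := by
      rw [← map_pow, Complex.I_sq]
      simp
    simp only [map_zero, map_mul, map_neg, map_pow]
    linear_combination (Polynomial.C (w : ℂ)) ^ 2 * hI
  rw [h, Polynomial.roots_mul (mul_ne_zero (Polynomial.X_sub_C_ne_zero _)
    (Polynomial.X_sub_C_ne_zero _)), Polynomial.roots_X_sub_C, Polynomial.roots_X_sub_C]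
  rfl

/-! ### Trigonometric integrals over one period -/

/-- Integral over a period of a trigonometric polynomial, from a primitive. -/
theorem integral_two_pi_eq {f F : ℝ → ℝ} (hf : Continuous f) (hF : ∀ θ, HasDerivAt F (f θ) θ) :
    ∫ θ in (0 : ℝ)..2 * Real.pi, f θ = F (2 * Real.pi) - F 0 :=
  intervalIntegral.integral_eq_sub_of_hasDerivAt (fun θ _ => hF θ) (hf.intervalIntegrable _ _)

theorem hasDerivAt_cos_pow_mul_sin_pow (m n : ℕ) (θ : ℝ) :
    HasDerivAt (fun θ => Real.cos θ ^ m * Real.sin θ ^ n)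
      (m * Real.cos θ ^ (m - 1) * -Real.sin θ * Real.sin θ ^ n +
        Real.cos θ ^ m * (n * Real.sin θ ^ (n - 1) * Real.cos θ)) θ :=
  ((Real.hasDerivAt_cos θ).fun_pow m).fun_mul ((Real.hasDerivAt_sin θ).fun_pow n)

/-- An odd form changes sign under `θ ↦ θ + π`, so its mean is zero. The proof exhibits a primitive,
with exponents `0` written out so that one derivative lemma covers every monomial. -/
theorem integral_cubic_cos_sin (k₀ k₁ k₂ k₃ : ℝ) :
    ∫ θ in (0 : ℝ)..2 * Real.pi, (k₀ * Real.cos θ ^ 3 + k₁ * Real.cos θ ^ 2 * Real.sin θ +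
      k₂ * Real.cos θ * Real.sin θ ^ 2 + k₃ * Real.sin θ ^ 3) = 0 := by
  have h := hasDerivAt_cos_pow_mul_sin_pow
  rw [integral_two_pi_eq (F := fun θ =>
    k₀ * (Real.cos θ ^ 0 * Real.sin θ ^ 1 - (Real.cos θ ^ 0 * Real.sin θ ^ 3) / 3) -
    k₁ / 3 * (Real.cos θ ^ 3 * Real.sin θ ^ 0) + k₂ / 3 * (Real.cos θ ^ 0 * Real.sin θ ^ 3) +
    k₃ * ((Real.cos θ ^ 3 * Real.sin θ ^ 0) / 3 - Real.cos θ ^ 1 * Real.sin θ ^ 0)) (by fun_prop)]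
  · simp
  · intro θ
    refine ((((((h 0 1 θ).fun_sub ((h 0 3 θ).div_const 3)).const_mul k₀).fun_sub
      ((h 3 0 θ).const_mul (k₁ / 3))).fun_add ((h 0 3 θ).const_mul (k₂ / 3))).fun_add
      ((((h 3 0 θ).div_const 3).fun_sub (h 1 0 θ)).const_mul k₃)).congr_deriv ?_
    have hcs := Real.sin_sq_add_cos_sq θ
    generalize Real.cos θ = c at *
    generalize Real.sin θ = s at *
    norm_num
    grind

theorem integral_quartic_cos_sin (k₀ k₁ k₂ k₃ k₄ : ℝ) :
    ∫ θ in (0 : ℝ)..2 * Real.pi, (k₀ * Real.cos θ ^ 4 + k₁ * Real.cos θ ^ 3 * Real.sin θ +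
      k₂ * Real.cos θ ^ 2 * Real.sin θ ^ 2 + k₃ * Real.cos θ * Real.sin θ ^ 3 +
      k₄ * Real.sin θ ^ 4) = Real.pi / 4 * (3 * k₀ + k₂ + 3 * k₄) := by
  have h := hasDerivAt_cos_pow_mul_sin_pow
  rw [integral_two_pi_eq (F := fun θ =>
    (3 * k₀ + k₂ + 3 * k₄) / 8 * θ +
    (3 * k₀ + k₂ - 5 * k₄) / 8 * (Real.cos θ ^ 1 * Real.sin θ ^ 1) +
    (k₀ - k₂ + k₄) / 4 * (Real.cos θ ^ 3 * Real.sin θ ^ 1) -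
    k₁ / 4 * (Real.cos θ ^ 4 * Real.sin θ ^ 0) + k₃ / 4 * (Real.cos θ ^ 0 * Real.sin θ ^ 4))
    (by fun_prop)]
  · simp
    ring
  · intro θ
    refine ((((((hasDerivAt_id θ).const_mul ((3 * k₀ + k₂ + 3 * k₄) / 8)).fun_add
      ((h 1 1 θ).const_mul _)).fun_add ((h 3 1 θ).const_mul _)).fun_sub
      ((h 4 0 θ).const_mul _)).fun_add ((h 0 4 θ).const_mul _)).congr_deriv ?_
    have hcs := Real.sin_sq_add_cos_sq θ
    generalize Real.cos θ = c at *
    generalize Real.sin θ = s at *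
    norm_num
    grind

theorem integral_sextic_cos_sin (k₀ k₁ k₂ k₃ k₄ k₅ k₆ : ℝ) :
    ∫ θ in (0 : ℝ)..2 * Real.pi, (k₀ * Real.cos θ ^ 6 + k₁ * Real.cos θ ^ 5 * Real.sin θ +
      k₂ * Real.cos θ ^ 4 * Real.sin θ ^ 2 + k₃ * Real.cos θ ^ 3 * Real.sin θ ^ 3 +
      k₄ * Real.cos θ ^ 2 * Real.sin θ ^ 4 + k₅ * Real.cos θ * Real.sin θ ^ 5 +
      k₆ * Real.sin θ ^ 6) = Real.pi / 8 * (5 * k₀ + k₂ + k₄ + 5 * k₆) := by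
  have h := hasDerivAt_cos_pow_mul_sin_pow
  have h6 : ∫ θ in (0 : ℝ)..2 * Real.pi, ((k₀ - k₂ + k₄ - k₆) * Real.cos θ ^ 6 +
      k₁ * Real.cos θ ^ 5 * Real.sin θ +
      k₃ * (Real.cos θ ^ 3 * Real.sin θ - Real.cos θ ^ 5 * Real.sin θ) +
      k₅ * Real.cos θ * Real.sin θ ^ 5) = 5 * Real.pi / 8 * (k₀ - k₂ + k₄ - k₆) := by
    rw [integral_two_pi_eq (F := fun θ =>
      (k₀ - k₂ + k₄ - k₆) * (5 / 16 * θ + 5 / 16 * (Real.cos θ ^ 1 * Real.sin θ ^ 1) +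
        5 / 24 * (Real.cos θ ^ 3 * Real.sin θ ^ 1) + 1 / 6 * (Real.cos θ ^ 5 * Real.sin θ ^ 1)) -
      (k₁ - k₃) / 6 * (Real.cos θ ^ 6 * Real.sin θ ^ 0) -
      k₃ / 4 * (Real.cos θ ^ 4 * Real.sin θ ^ 0) + k₅ / 6 * (Real.cos θ ^ 0 * Real.sin θ ^ 6))
      (by fun_prop)]
    · simp
      ring
    · intro θ
      refine (((((((((hasDerivAt_id θ).const_mul (5 / 16)).fun_add
        ((h 1 1 θ).const_mul _)).fun_add ((h 3 1 θ).const_mul _)).fun_add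
        ((h 5 1 θ).const_mul _)).const_mul _).fun_sub
        ((h 6 0 θ).const_mul _)).fun_sub ((h 4 0 θ).const_mul _)).fun_add
        ((h 0 6 θ).const_mul _)).congr_deriv ?_
      have hcs := Real.sin_sq_add_cos_sq θ
      generalize Real.cos θ = c at *
      generalize Real.sin θ = s at *
      norm_num
      grind
  have h4 := integral_quartic_cos_sin (k₂ - k₄ + k₆) 0 (k₄ - k₆) 0 k₆
  -- Replacing `sin²` by `1 - cos²` reduces each even monomial to a multiple of `cos⁶` plus a
  -- quartic form; the odd ones have primitives by substitution.
  have hsplit : ∀ θ : ℝ, k₀ * Real.cos θ ^ 6 + k₁ * Real.cos θ ^ 5 * Real.sin θ +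
      k₂ * Real.cos θ ^ 4 * Real.sin θ ^ 2 + k₃ * Real.cos θ ^ 3 * Real.sin θ ^ 3 +
      k₄ * Real.cos θ ^ 2 * Real.sin θ ^ 4 + k₅ * Real.cos θ * Real.sin θ ^ 5 +
      k₆ * Real.sin θ ^ 6 =
      ((k₀ - k₂ + k₄ - k₆) * Real.cos θ ^ 6 +
      k₁ * Real.cos θ ^ 5 * Real.sin θ +
      k₃ * (Real.cos θ ^ 3 * Real.sin θ - Real.cos θ ^ 5 * Real.sin θ) +
      k₅ * Real.cos θ * Real.sin θ ^ 5) +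
      ((k₂ - k₄ + k₆) * Real.cos θ ^ 4 + 0 * Real.cos θ ^ 3 * Real.sin θ +
      (k₄ - k₆) * Real.cos θ ^ 2 * Real.sin θ ^ 2 + 0 * Real.cos θ * Real.sin θ ^ 3 +
      k₆ * Real.sin θ ^ 4) := by
    intro θ
    have hcs := Real.sin_sq_add_cos_sq θ
    generalize Real.cos θ = c at *
    generalize Real.sin θ = s at *
    grind
  simp only [hsplit]
  rw [intervalIntegral.integral_add (Continuous.intervalIntegrable (by fun_prop) _ _)
    (Continuous.intervalIntegrable (by fun_prop) _ _), h6, h4]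
  ring

/-- The integral of `A₀ / w`, that is `W(0)`. Quadratic terms of the field projected on the radial
direction give a cubic form, so the squared term in `W'(0)` disappears. -/
theorem integral_quadratic_terms (l m e f w p q p' q' : ℝ) :
    ∫ θ in (0 : ℝ)..2 * Real.pi, ((Real.cos θ - Real.sin θ * e) *
      (p * (Real.cos θ * (Real.cos θ * l + Real.sin θ * m)) +
        q * (Real.cos θ * l + Real.sin θ * m) ^ 2) +
      -(Real.sin θ * f) * (p' * (Real.cos θ * (Real.cos θ * l + Real.sin θ * m)) +
        q' * (Real.cos θ * l + Real.sin θ * m) ^ 2)) / w = 0 := by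
  have h := integral_cubic_cos_sin (p * l + q * l ^ 2)
    (p * m + 2 * q * l * m - e * (p * l + q * l ^ 2) - f * (p' * l + q' * l ^ 2))
    (q * m ^ 2 - e * (p * m + 2 * q * l * m) - f * (p' * m + 2 * q' * l * m))
    (-e * q * m ^ 2 - f * q' * m ^ 2)
  rw [intervalIntegral.integral_div, div_eq_zero_iff]
  refine Or.inl (Eq.trans (intervalIntegral.integral_congr fun θ _ => ?_) h)
  ring

/-- The second-order averaging integral of a planar field with quadratic terms `p, q`, `p', q'` and
cubic terms `u, v, z`, `u', v', z'` along the ellipse `(cos θ, cos θ * l + sin θ * m)`. -/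
theorem integral_resonant_terms (l m e f w p q p' q' u v z u' v' z' : ℝ) :
    ∫ θ in (0 : ℝ)..2 * Real.pi, (((Real.cos θ - Real.sin θ * e) *
      (u * (Real.cos θ ^ 2 * (Real.cos θ * l + Real.sin θ * m)) +
        v * (Real.cos θ * (Real.cos θ * l + Real.sin θ * m) ^ 2) +
        z * (Real.cos θ * l + Real.sin θ * m) ^ 3) +
      -(Real.sin θ * f) * (u' * (Real.cos θ ^ 2 * (Real.cos θ * l + Real.sin θ * m)) +
        v' * (Real.cos θ * (Real.cos θ * l + Real.sin θ * m) ^ 2) +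
        z' * (Real.cos θ * l + Real.sin θ * m) ^ 3)) / w -
      ((Real.cos θ - Real.sin θ * e) *
      (p * (Real.cos θ * (Real.cos θ * l + Real.sin θ * m)) +
        q * (Real.cos θ * l + Real.sin θ * m) ^ 2) +
      -(Real.sin θ * f) * (p' * (Real.cos θ * (Real.cos θ * l + Real.sin θ * m)) +
        q' * (Real.cos θ * l + Real.sin θ * m) ^ 2)) *
      (-(Real.cos θ * e + Real.sin θ) *
      (p * (Real.cos θ * (Real.cos θ * l + Real.sin θ * m)) +
        q * (Real.cos θ * l + Real.sin θ * m) ^ 2) +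
      -(Real.cos θ * f) * (p' * (Real.cos θ * (Real.cos θ * l + Real.sin θ * m)) +
        q' * (Real.cos θ * l + Real.sin θ * m) ^ 2)) / w ^ 2) =
    Real.pi / 4 * (3 * (u * l + v * l ^ 2 + z * l ^ 3) +
      (v * m ^ 2 + 3 * z * l * m ^ 2 - e * (u * m + 2 * v * l * m + 3 * z * l ^ 2 * m) -
        f * (u' * m + 2 * v' * l * m + 3 * z' * l ^ 2 * m)) +
      3 * (-e * z * m ^ 3 - f * z' * m ^ 3)) / w -
    Real.pi / 8 * (5 * ((p * l + q * l ^ 2) *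
        (-e * (p * l + q * l ^ 2) - f * (p' * l + q' * l ^ 2))) +
      ((p * l + q * l ^ 2) *
          (-(p * m + 2 * q * l * m) - e * (q * m ^ 2) - f * (q' * m ^ 2)) +
        (p * m + 2 * q * l * m - e * (p * l + q * l ^ 2) - f * (p' * l + q' * l ^ 2)) *
          (-(p * l + q * l ^ 2) - e * (p * m + 2 * q * l * m) - f * (p' * m + 2 * q' * l * m)) +
        (q * m ^ 2 - e * (p * m + 2 * q * l * m) - f * (p' * m + 2 * q' * l * m)) *
          (-e * (p * l + q * l ^ 2) - f * (p' * l + q' * l ^ 2))) +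
      ((p * m + 2 * q * l * m - e * (p * l + q * l ^ 2) - f * (p' * l + q' * l ^ 2)) *
          -(q * m ^ 2) +
        (q * m ^ 2 - e * (p * m + 2 * q * l * m) - f * (p' * m + 2 * q' * l * m)) *
          (-(p * m + 2 * q * l * m) - e * (q * m ^ 2) - f * (q' * m ^ 2)) +
        (-e * q * m ^ 2 - f * q' * m ^ 2) *
          (-(p * l + q * l ^ 2) - e * (p * m + 2 * q * l * m) - f * (p' * m + 2 * q' * l * m))) +
      5 * ((-e * q * m ^ 2 - f * q' * m ^ 2) * -(q * m ^ 2))) / w ^ 2 := by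
  have hA (c s : ℝ) : (c - s * e) * (p * (c * (c * l + s * m)) + q * (c * l + s * m) ^ 2) +
      -(s * f) * (p' * (c * (c * l + s * m)) + q' * (c * l + s * m) ^ 2) =
      (p * l + q * l ^ 2) * c ^ 3 +
      (p * m + 2 * q * l * m - e * (p * l + q * l ^ 2) - f * (p' * l + q' * l ^ 2)) * c ^ 2 * s +
      (q * m ^ 2 - e * (p * m + 2 * q * l * m) - f * (p' * m + 2 * q' * l * m)) * c * s ^ 2 +
      (-e * q * m ^ 2 - f * q' * m ^ 2) * s ^ 3 := by ring
  have hC (c s : ℝ) : -(c * e + s) * (p * (c * (c * l + s * m)) + q * (c * l + s * m) ^ 2) +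
      -(c * f) * (p' * (c * (c * l + s * m)) + q' * (c * l + s * m) ^ 2) =
      (-e * (p * l + q * l ^ 2) - f * (p' * l + q' * l ^ 2)) * c ^ 3 +
      (-(p * l + q * l ^ 2) - e * (p * m + 2 * q * l * m) - f * (p' * m + 2 * q' * l * m)) *
        c ^ 2 * s +
      (-(p * m + 2 * q * l * m) - e * (q * m ^ 2) - f * (q' * m ^ 2)) * c * s ^ 2 +
      -(q * m ^ 2) * s ^ 3 := by ring
  have hB (c s : ℝ) : (c - s * e) * (u * (c ^ 2 * (c * l + s * m)) +
        v * (c * (c * l + s * m) ^ 2) + z * (c * l + s * m) ^ 3) +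
      -(s * f) * (u' * (c ^ 2 * (c * l + s * m)) +
        v' * (c * (c * l + s * m) ^ 2) + z' * (c * l + s * m) ^ 3) =
      (u * l + v * l ^ 2 + z * l ^ 3) * c ^ 4 +
      (u * m + 2 * v * l * m + 3 * z * l ^ 2 * m - e * (u * l + v * l ^ 2 + z * l ^ 3) -
        f * (u' * l + v' * l ^ 2 + z' * l ^ 3)) * c ^ 3 * s +
      (v * m ^ 2 + 3 * z * l * m ^ 2 - e * (u * m + 2 * v * l * m + 3 * z * l ^ 2 * m) -
        f * (u' * m + 2 * v' * l * m + 3 * z' * l ^ 2 * m)) * c ^ 2 * s ^ 2 +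
      (z * m ^ 3 - e * (v * m ^ 2 + 3 * z * l * m ^ 2) - f * (v' * m ^ 2 + 3 * z' * l * m ^ 2)) *
        c * s ^ 3 +
      (-e * z * m ^ 3 - f * z' * m ^ 3) * s ^ 4 := by ring
  have hprod (x₀ x₁ x₂ x₃ y₀ y₁ y₂ y₃ c s : ℝ) :
      (x₀ * c ^ 3 + x₁ * c ^ 2 * s + x₂ * c * s ^ 2 + x₃ * s ^ 3) *
        (y₀ * c ^ 3 + y₁ * c ^ 2 * s + y₂ * c * s ^ 2 + y₃ * s ^ 3) =
      x₀ * y₀ * c ^ 6 + (x₀ * y₁ + x₁ * y₀) * c ^ 5 * s +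
      (x₀ * y₂ + x₁ * y₁ + x₂ * y₀) * c ^ 4 * s ^ 2 +
      (x₀ * y₃ + x₁ * y₂ + x₂ * y₁ + x₃ * y₀) * c ^ 3 * s ^ 3 +
      (x₁ * y₃ + x₂ * y₂ + x₃ * y₁) * c ^ 2 * s ^ 4 + (x₂ * y₃ + x₃ * y₂) * c * s ^ 5 +
      x₃ * y₃ * s ^ 6 := by ring
  simp only [hA, hB, hC, hprod]
  rw [intervalIntegral.integral_sub (Continuous.intervalIntegrable (by fun_prop) _ _)
    (Continuous.intervalIntegrable (by fun_prop) _ _), intervalIntegral.integral_div,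
    intervalIntegral.integral_div, integral_quartic_cos_sin, integral_sextic_cos_sin]

/-! ### The boundary field in polar form and the main result -/

/-- The vectors `(1, -a₁ / a₂)` and `(0, -w / a₂)` are the points with `(ξ, η) = (1, 0)` and `(0,
1)`. The index type runs over the vertex sets of both graphs, and the factor `6` is the one in
`d'''(0) = 6 W'(0)`. -/
theorem boundaryField_isPolarField {V₁ V₂ : Type*} [Fintype V₁] [DecidableEq V₁] [Fintype V₂]
    [DecidableEq V₂] (G₁ : SimpleGraph V₁) [DecidableRel G₁.Adj] (G₂ : SimpleGraph V₂)
    [DecidableRel G₂.Adj] (hG₁ : ∀ v, ∃ w, G₁.Adj v w) (hG₂ : ∀ v, ∃ w, G₂.Adj v w)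
    {a₁ a₂ a₃ a₄ w : ℝ} (htrace : a₁ + a₄ = 0) (hw : 0 < w) (hw2 : w ^ 2 = a₁ * a₄ - a₂ * a₃)
    (ha₂ : a₂ ≠ 0) :
    ∃ α β : Finset V₁ ⊕ Finset V₂ → ℝ → ℝ, (∀ i, Continuous (α i)) ∧ (∀ i, Continuous (β i)) ∧
      IsPolarField (boundaryField G₁ G₂ a₁ a₂ a₃ a₄) (1, -a₁ / a₂) (0, -w / a₂) w
        (angularSum (Sum.elim G₁.boundaryDegree G₂.boundaryDegree) α)
        (angularSum (Sum.elim G₁.boundaryDegree G₂.boundaryDegree) β) ∧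
      ((∫ θ in (0 : ℝ)..2 * Real.pi,
        ((∑ i with Sum.elim G₁.boundaryDegree G₂.boundaryDegree i = 1, α i θ) / w -
          angularSum (Sum.elim G₁.boundaryDegree G₂.boundaryDegree) α 0 θ *
          angularSum (Sum.elim G₁.boundaryDegree G₂.boundaryDegree) β 0 θ / w ^ 2)) +
        (∫ θ in (0 : ℝ)..2 * Real.pi,
          angularSum (Sum.elim G₁.boundaryDegree G₂.boundaryDegree) α 0 θ / w) ^ 2) * 6 =
        generalizedLiapunov G₁ G₂ a₁ a₂ a₃ a₄ := by
  set d := Sum.elim G₁.boundaryDegree G₂.boundaryDegree with hd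
  set μ : ℝ → ℝ := fun θ => Real.cos θ * (-a₁ / a₂) + Real.sin θ * (-w / a₂) with hμ
  let t₁ : Finset V₁ → ℝ → ℝ := fun S θ => G₁.boundaryTerm S (Real.cos θ) (μ θ)
  let t₂ : Finset V₂ → ℝ → ℝ := fun S θ => G₂.boundaryTerm S (Real.cos θ) (μ θ)
  have ht₁ (S) : Continuous (t₁ S) := by
    simp only [t₁, SimpleGraph.boundaryTerm, hμ]
    split_ifs <;> fun_prop
  have ht₂ (S) : Continuous (t₂ S) := by
    simp only [t₂, SimpleGraph.boundaryTerm, hμ]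
    split_ifs <;> fun_prop
  -- A vector `(X, Y)` has `ξ = X`, `η = -(a₁ X + a₂ Y) / w`. Its radial part `ξ cos θ + η sin θ` is
  -- `p₁ X + p₂ Y`, and its angular part `η cos θ - ξ sin θ` is `q₁ X + q₂ Y`.
  let p₁ : ℝ → ℝ := fun θ => Real.cos θ - Real.sin θ * (a₁ / w)
  let p₂ : ℝ → ℝ := fun θ => -(Real.sin θ * (a₂ / w))
  let q₁ : ℝ → ℝ := fun θ => -(Real.cos θ * (a₁ / w) + Real.sin θ)
  let q₂ : ℝ → ℝ := fun θ => -(Real.cos θ * (a₂ / w))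
  let α : Finset V₁ ⊕ Finset V₂ → ℝ → ℝ :=
    Sum.elim (fun S θ => p₁ θ * t₁ S θ) (fun S θ => p₂ θ * t₂ S θ)
  let β : Finset V₁ ⊕ Finset V₂ → ℝ → ℝ :=
    Sum.elim (fun S θ => q₁ θ * t₁ S θ) (fun S θ => q₂ θ * t₂ S θ)
  have hα (i) : Continuous (α i) := by
    rcases i with S | S
    · exact Continuous.mul (by fun_prop) (ht₁ S)
    · exact Continuous.mul (by fun_prop) (ht₂ S)
  have hβ (i) : Continuous (β i) := by
    rcases i with S | S
    · exact Continuous.mul (by fun_prop) (ht₁ S)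
    · exact Continuous.mul (by fun_prop) (ht₂ S)
  let n₁ : ℝ → ℝ → ℝ := fun r θ => ∑ S, r ^ G₁.boundaryDegree S * t₁ S θ
  let n₂ : ℝ → ℝ → ℝ := fun r θ => ∑ S, r ^ G₂.boundaryDegree S * t₂ S θ
  have hA (r θ) : angularSum d α r θ = p₁ θ * n₁ r θ + p₂ θ * n₂ r θ := by
    simp only [angularSum, Fintype.sum_sum_type, d, α, Sum.elim_inl, Sum.elim_inr, n₁, n₂,
      Finset.mul_sum, mul_left_comm]
  have hC (r θ) : angularSum d β r θ = q₁ θ * n₁ r θ + q₂ θ * n₂ r θ := by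
    simp only [angularSum, Fintype.sum_sum_type, d, β, Sum.elim_inl, Sum.elim_inr, n₁, n₂,
      Finset.mul_sum, mul_left_comm]
  have hμp (θ) : μ (θ + 2 * Real.pi) = μ θ := by simp [hμ]
  have ha₃ : a₃ = -(w ^ 2 + a₁ ^ 2) / a₂ := by
    rw [eq_div_iff ha₂, hw2]
    linear_combination a₁ * htrace
  have ha₄ : a₄ = -a₁ := by linarith
  refine ⟨α, β, hα, hβ, ⟨?_, hw, fun r θ => ?_, continuous_angularSum hβ, fun r θ => ?_,
    fun r θ => ?_⟩, ?_⟩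
  · simp [hw.ne', ha₂]
  · have he : r • ellipseMap (1, -a₁ / a₂) (0, -w / a₂) θ = (r * Real.cos θ, r * μ θ) := by
      simp [ellipseMap, hμ]
    have he' : ellipseMap (1, -a₁ / a₂) (0, -w / a₂) θ = (Real.cos θ, μ θ) := by
      simp [ellipseMap, hμ]
    have he'' : ellipseMap (0, -w / a₂) (-(1, -a₁ / a₂)) θ =
        (-Real.sin θ, Real.cos θ * (-w / a₂) + Real.sin θ * (a₁ / a₂)) := by
      simp [ellipseMap, neg_div]
    rw [he, he', he'', boundaryField, hA, hC, G₁.boundaryPolynomial_mul hG₁,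
      G₂.boundaryPolynomial_mul hG₂]
    change (a₁ * (r * Real.cos θ) + a₂ * (r * μ θ) + (1 + r ^ 2 * n₁ r θ) - 1,
      a₃ * (r * Real.cos θ) + a₄ * (r * μ θ) + (1 + r ^ 2 * n₂ r θ) - 1) = _
    generalize n₁ r θ = x₁
    generalize n₂ r θ = x₂
    have hcs := Real.sin_sq_add_cos_sq θ
    simp only [p₁, p₂, q₁, q₂, hμ]
    generalize Real.cos θ = c at *
    generalize Real.sin θ = s at *
    subst ha₃ ha₄
    have hw0 := hw.ne'
    ext
    · simp only [Prod.smul_mk, smul_eq_mul, Prod.mk_add_mk]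
      field_simp
      linear_combination (-w * r ^ 2 * x₁) * hcs
    · simp only [Prod.smul_mk, smul_eq_mul, Prod.mk_add_mk]
      field_simp
      linear_combination (-w * a₂ * r ^ 2 * x₂) * hcs
  · simp only [hA, n₁, n₂, t₁, t₂, p₁, p₂, hμp, Real.cos_add_two_pi, Real.sin_add_two_pi]
  · simp only [hC, n₁, n₂, t₁, t₂, q₁, q₂, hμp, Real.cos_add_two_pi, Real.sin_add_two_pi]
  · have hn₁ (θ) : n₁ 0 θ = G₁.boundaryCoeff 1 1 * (Real.cos θ * μ θ) +
        G₁.boundaryCoeff 0 2 * μ θ ^ 2 := by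
      have := angularSum_zero G₁.boundaryDegree t₁ θ
      rw [show n₁ 0 θ = angularSum G₁.boundaryDegree t₁ 0 θ from rfl, this]
      simp only [t₁]
      rw [G₁.sum_boundaryTerm hG₁]
      simp [Finset.sum_Icc_succ_top]
    have hn₂ (θ) : n₂ 0 θ = G₂.boundaryCoeff 1 1 * (Real.cos θ * μ θ) +
        G₂.boundaryCoeff 0 2 * μ θ ^ 2 := by
      have := angularSum_zero G₂.boundaryDegree t₂ θ
      rw [show n₂ 0 θ = angularSum G₂.boundaryDegree t₂ 0 θ from rfl, this]
      simp only [t₂]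
      rw [G₂.sum_boundaryTerm hG₂]
      simp [Finset.sum_Icc_succ_top]
    have h1 (θ) : ∑ i with d i = 1, α i θ =
        p₁ θ * (G₁.boundaryCoeff 2 1 * (Real.cos θ ^ 2 * μ θ) +
          G₁.boundaryCoeff 1 2 * (Real.cos θ * μ θ ^ 2) + G₁.boundaryCoeff 0 3 * μ θ ^ 3) +
        p₂ θ * (G₂.boundaryCoeff 2 1 * (Real.cos θ ^ 2 * μ θ) +
          G₂.boundaryCoeff 1 2 * (Real.cos θ * μ θ ^ 2) + G₂.boundaryCoeff 0 3 * μ θ ^ 3) := by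
      have h2 := G₁.sum_boundaryTerm hG₁ 1 (Real.cos θ) (μ θ)
      have h3 := G₂.sum_boundaryTerm hG₂ 1 (Real.cos θ) (μ θ)
      simp [Finset.sum_Icc_succ_top] at h2 h3
      rw [← h2, ← h3, Finset.sum_filter, Fintype.sum_sum_type, Finset.sum_filter,
        Finset.sum_filter, Finset.mul_sum, Finset.mul_sum]
      simp only [d, α, Sum.elim_inl, Sum.elim_inr, mul_ite, mul_zero, t₁, t₂]
      rfl
    simp only [h1, hA, hC, hn₁, hn₂]
    rw [generalizedLiapunov]
    generalize (G₁.boundaryCoeff 1 1 : ℝ) = p11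
    generalize (G₁.boundaryCoeff 0 2 : ℝ) = p02
    generalize (G₁.boundaryCoeff 2 1 : ℝ) = p21
    generalize (G₁.boundaryCoeff 1 2 : ℝ) = p12
    generalize (G₁.boundaryCoeff 0 3 : ℝ) = p03
    generalize (G₂.boundaryCoeff 1 1 : ℝ) = q11
    generalize (G₂.boundaryCoeff 0 2 : ℝ) = q02
    generalize (G₂.boundaryCoeff 2 1 : ℝ) = q21
    generalize (G₂.boundaryCoeff 1 2 : ℝ) = q12
    generalize (G₂.boundaryCoeff 0 3 : ℝ) = q03
    simp only [p₁, p₂, q₁, q₂, hμ]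
    have hσ : (a₁ * a₄ - a₂ * a₃) ^ (3 / 2 : ℝ) = w ^ 3 := by
      rw [← hw2, ← Real.rpow_natCast w 2, ← Real.rpow_mul hw.le, ← Real.rpow_natCast w 3]
      norm_num
    rw [integral_resonant_terms, integral_quadratic_terms, hσ]
    -- With `a₃` and `a₄` eliminated the claim is a rational identity in `a₁`, `a₂`, `w`. The
    -- coefficient `p03` drops out: it is multiplied by `(l² + m²)(l - e m)`, and `l = e m = -a₁ /
    -- a₂`.
    subst ha₃ ha₄
    have hw0 := hw.ne'
    field_simp
    ring

/-- The section is the line `a₁ x + a₂ y = 0`, parametrized by the abscissa: it is the positive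
`ξ`-axis in the coordinates `ξ = x`, `η = -(a₁ x + a₂ y) / √σ`, in which the linear part takes the
canonical form `(ξ, η) ↦ (-√σ η, √σ ξ)`. -/
theorem proposition3p7 {V₁ V₂ : Type*} [Fintype V₁] [DecidableEq V₁] [Fintype V₂] [DecidableEq V₂]
    (G₁ : SimpleGraph V₁) [DecidableRel G₁.Adj] (G₂ : SimpleGraph V₂) [DecidableRel G₂.Adj]
    (hn₁ : 2 ≤ Fintype.card V₁) (hn₂ : 2 ≤ Fintype.card V₂)
    (hG₁ : ∀ v, ∃ w, G₁.Adj v w) (hG₂ : ∀ v, ∃ w, G₂.Adj v w)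
    (a₁ a₂ a₃ a₄ : ℝ) (htrace : a₁ + a₄ = 0) (hdet : 0 < a₁ * a₄ - a₂ * a₃) :
    -- the Jacobian matrix at the origin has the eigenvalues `± i √σ`
    ((jacobianMatrix (boundaryField G₁ G₂ a₁ a₂ a₃ a₄) 0).map Complex.ofReal).charpoly.roots =
        {Complex.I * (√(a₁ * a₄ - a₂ * a₃) : ℝ), -(Complex.I * (√(a₁ * a₄ - a₂ * a₃) : ℝ))} ∧
    -- the origin is a center or a focus, and a focus if the Liapunov number is nonzero
    (IsCenter (boundaryField G₁ G₂ a₁ a₂ a₃ a₄) ∨ IsFocus (boundaryField G₁ G₂ a₁ a₂ a₃ a₄)) ∧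
    (generalizedLiapunov G₁ G₂ a₁ a₂ a₃ a₄ ≠ 0 → IsFocus (boundaryField G₁ G₂ a₁ a₂ a₃ a₄)) ∧
    -- the Poincare map has derivative `1` at the origin and the stated Liapunov number
    IsLiapunovNumber (boundaryField G₁ G₂ a₁ a₂ a₃ a₄) (1, -a₁ / a₂)
      (generalizedLiapunov G₁ G₂ a₁ a₂ a₃ a₄) := by
  obtain ⟨hw, hw2⟩ : 0 < √(a₁ * a₄ - a₂ * a₃) ∧ √(a₁ * a₄ - a₂ * a₃) ^ 2 = a₁ * a₄ - a₂ * a₃ :=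
    ⟨Real.sqrt_pos.2 hdet, Real.sq_sqrt hdet.le⟩
  have ha₂ : a₂ ≠ 0 := by
    rintro rfl
    have : a₄ = -a₁ := by linarith
    subst this
    nlinarith [sq_nonneg a₁]
  refine ⟨?_, ?_⟩
  · rw [jacobianMatrix_boundaryField G₁ G₂ hG₁ hG₂]
    exact roots_charpoly_of_trace_zero htrace hdet
  obtain ⟨α, β, hα, hβ, hF, hl⟩ :=
    boundaryField_isPolarField G₁ G₂ hG₁ hG₂ htrace hw hw2 ha₂
  obtain ⟨W, hWa, hW', hcenter, hfocus, hP⟩ := hF.exists_displacement hα hβ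
  rw [← hl]
  refine ⟨?_, fun hne => ?_, fun s => s + s ^ 2 * W s, hP, ?_, ?_, ?_⟩
  -- Zeros of an analytic function are isolated unless it vanishes identically near the point.
  · rcases hWa.eventually_eq_zero_or_eventually_ne_zero with h | h
    · exact Or.inl (hcenter h)
    · exact Or.inr (hfocus h)
  · rcases hWa.eventually_eq_zero_or_eventually_ne_zero with h | h
    · have h0 : HasDerivAt W 0 0 :=
        (hasDerivAt_const (0 : ℝ) (0 : ℝ)).congr_of_eventuallyEq h
      rw [hW'.unique h0, zero_mul] at hne
      exact absurd rfl hne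
    · exact hfocus h
  · exact analyticAt_id.add ((analyticAt_id.pow 2).mul hWa)
  · have h := (hasDerivAt_id' (0 : ℝ)).fun_add (((hasDerivAt_id' (0 : ℝ)).fun_pow 2).fun_mul hW')
    simpa using h.deriv
  · simp only [add_sub_cancel_left]
    rw [iteratedDeriv_three_sq_mul hWa hW', mul_comm]
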